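/- Let $\mathbb D=\{z\in\mathbb C:|z|<1\}$ and, for $f$ holomorphic on $\mathbb D$, let $\hat f(k)$ be its Taylor coefficients at $0$. Put $$\|f\|_{H^2}=\Big(\sum_{k\ge0}|\hat f(k)|^2\Big)^{1/2},\quad \|f\|_{L^2_a}=\Big(\sum_{k\ge0}\frac{|\hat f(k)|^2}{k+1}\Big)^{1/2},\quad \|f\|_{B^{1/2}_{2,2}}=\Big(\sum_{k\ge0}(k+1)|\hat f(k)|^2\Big)^{1/2};$$ the Hardy space $H^2$, the Bergman space $L^2_a$ and the Dirichlet space $B^{1/2}_{2,2}$ consist of the holomorphic $f$ for which the respective norm is finite. For an integer $n\ge1$ and $r\in[0,1)$, let $\mathcal R_{n,r}$ be the set of rational functions $p/q$ with polynomials $p,q$, $\deg p\le n-1$, $\deg q\le n$, such that every zero $\zeta$ of $q$ satisfies $|\zeta|\ge 1/r$ (if $r=0$: $q$ has no zeros, so that $\mathcal R_{n,0}$ is the space of polynomials of degree at most $n-1$). Let $\mathcal C_{n,r}(L^2_a,H^2)$ be the smallest constant $C$ with $\|f'\|_{L^2_a}\le C\|f\|_{H^2}$ for all $f\in\mathcal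 R_{n,r}$. For a finite family $\sigma$ of points of $\mathbb D$, repeated according to multiplicity, write $g_{|\sigma}=f_{|\sigma}$ if $g^{(k)}(\mu)=f^{(k)}(\mu)$ for every $\mu\in\sigma$ and every $k$ less than the multiplicity of $\mu$ in $\sigma$. Put $$I(\sigma)=I(\sigma,H^2,B^{1/2}_{2,2})=\sup_{\|f\|_{H^2}\le1}\ \inf\{\|g\|_{B^{1/2}_{2,2}}: g\in B^{1/2}_{2,2},\ g_{|\sigma}=f_{|\sigma}\},$$ $$\mathcal I_{n,r}=\sup\{I(\sigma): \operatorname{card}\sigma\le n\ \text{(with multiplicity)},\ |\mu|\le r\ \text{for all }\mu\in\sigma\}.$$ **Theorem B.** Let $n\ge1$ and $r\in[0,1)$. Then $$\mathcal I_{n,r}\le\big[\mathcal C_{n,r}(L^2_a,H^2)^2+1\big]^{1/2}.$$ For $\lambda\in\mathbb D$ and the family $\sigma_{n,\lambda}$ consisting of $\lambda$ repeated $n$ times, $$I(\sigma_{n,\lambda})\ \ge\ \sqrt{\frac n{1-|\lambda|}}\left[\frac{(1+|\lambda|)^2-\frac2n-\frac{2|\lambda|}n}{2(1+|\lambda|)}\right]^{1/2}$$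 (if $n=1$ the bracket is negative and its square root is read as $0$). In particular $$\left[\frac{1+r}2\Big(1-\frac1n\Big)\right]^{1/2}\sqrt{\frac n{1-r}}\ \le\ \mathcal I_{n,r}\ \le\ \Big(1+r+\frac1{\sqrt n}+\frac{1-r}n\Big)^{1/2}\sqrt{\frac n{1-r}};$$ hence there are absolute constants $c,C>0$ such that $c\sqrt{n/(1-r)}\le\mathcal I_{n,r}\le C\sqrt{n/(1-r)}$ for all $n\ge2$ and $r\in[0,1)$. Moreover, for every $r\in[0,1)$, $$\sqrt{\frac{(1+r)/2}{1-r}}\le\liminf_{n\to\infty}\frac{\mathcal I_{n,r}}{\sqrt n}\le\limsup_{n\to\infty}\frac{\mathcal I_{n,r}}{\sqrt n}\le\sqrt{\frac{1+r}{1-r}},$$ and $$\frac{\sqrt2}2\le\liminf_{r\to1^-}\liminf_{n\to\infty}\sqrt{\frac{1-r}n}\,\mathcal I_{n,r}\le\limsup_{r\to1^-}\limsup_{n\to\infty}\sqrt{\frac{1-r}n}\,\mathcal I_{n,r}\le\sqrt2 .$$ -/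

import Mathlib

open Set Filter Topology
open scoped ENNReal

noncomputable section

namespace DirichletInterpolation

/-- The open unit disc of the complex plane. -/
def disc : Set ℂ := Metric.ball (0 : ℂ) 1

/-- `f` is holomorphic on the unit disc (values of `f` off the disc play no role). -/
def Hol (f : ℂ → ℂ) : Prop := DifferentiableOn ℂ f disc

/-- The `k`-th Taylor coefficient of `f` at the origin. -/
def taylorCoeff (f : ℂ → ℂ) (k : ℕ) : ℂ := iteratedDeriv k f 0 / (Nat.factorial k : ℂ)

/-- The norm of the Hardy space `H²`, equal to `∞` when `f` (holomorphic on the disc) is not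
in `H²`. -/
def hardyNorm (f : ℂ → ℂ) : ℝ≥0∞ :=
  (∑' k : ℕ, ‖taylorCoeff f k‖ₑ ^ 2) ^ (1 / 2 : ℝ)

/-- The norm of the Bergman space `L²ₐ`, equal to `∞` when `f` (holomorphic on the disc) is not
in `L²ₐ`. -/
def bergmanNorm (f : ℂ → ℂ) : ℝ≥0∞ :=
  (∑' k : ℕ, ‖taylorCoeff f k‖ₑ ^ 2 / ((k : ℝ≥0∞) + 1)) ^ (1 / 2 : ℝ)

/-- The norm of the Dirichlet space (the analytic Besov space with indices `2, 2` and
smoothness `1/2`), equal to `∞` when `f` (holomorphic on the disc) is not in that space. -/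
def dirichletNorm (f : ℂ → ℂ) : ℝ≥0∞ :=
  (∑' k : ℕ, ((k : ℝ≥0∞) + 1) * ‖taylorCoeff f k‖ₑ ^ 2) ^ (1 / 2 : ℝ)

/-- The rational functions `p / q` with `deg p ≤ n - 1`, `deg q ≤ n` (so that the degree is at
most `n`), all of whose poles `ζ` satisfy `|ζ| ≥ 1 / r`. For `r = 0` there are no finite poles,
and these are the polynomials of degree at most `n - 1`. -/
def ratFunctions (n : ℕ) (r : ℝ) : Set (ℂ → ℂ) :=
  {f | ∃ p q : Polynomial ℂ, p.degree < (n : WithBot ℕ) ∧ q.degree ≤ (n : WithBot ℕ) ∧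
    (∀ ζ : ℂ, q.eval ζ = 0 → 1 ≤ r * ‖ζ‖) ∧ f = fun z => p.eval z / q.eval z}

/-- The best constant `C` in the Bernstein-type inequality `‖f'‖_X ≤ C ‖f‖_Y` for all `f` in
`ratFunctions n r`; the spaces `X`, `Y` are given by their (extended) norms. -/
def bernsteinConst (normX normY : (ℂ → ℂ) → ℝ≥0∞) (n : ℕ) (r : ℝ) : ℝ≥0∞ :=
  sInf {C : ℝ≥0∞ | ∀ f ∈ ratFunctions n r, normX (deriv f) ≤ C * normY f}

/-- `f` and `g` have the same trace on the finite family `σ` of points, repeated according to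
multiplicity: at a point of multiplicity `m`, the derivatives of orders `0, …, m - 1` agree. -/
def SameTrace (σ : Multiset ℂ) (f g : ℂ → ℂ) : Prop :=
  ∀ μ ∈ σ, ∀ k < σ.count μ, iteratedDeriv k g μ = iteratedDeriv k f μ

/-- The interpolation constant `I(σ, X, Y)`: the supremum over `f` in the unit ball of `X` of the
least `Y`-norm of the functions `g ∈ Y` with the same trace on `σ` as `f`. -/
def interpConst (normX normY : (ℂ → ℂ) → ℝ≥0∞) (σ : Multiset ℂ) : ℝ≥0∞ :=
  ⨆ f ∈ {f : ℂ → ℂ | Hol f ∧ normX f ≤ 1},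
    ⨅ g ∈ {g : ℂ → ℂ | Hol g ∧ normY g < ∞ ∧ SameTrace σ f g}, normY g

/-- The worst-case interpolation constant: the supremum of `I(σ, X, Y)` over all families `σ` of
at most `n` points of the disc (with multiplicities) of modulus at most `r`. -/
def worstInterpConst (normX normY : (ℂ → ℂ) → ℝ≥0∞) (n : ℕ) (r : ℝ) : ℝ≥0∞ :=
  ⨆ σ ∈ {σ : Multiset ℂ | σ.card ≤ n ∧ ∀ μ ∈ σ, μ ∈ disc ∧ ‖μ‖ ≤ r},
    interpConst normX normY σ

end DirichletInterpolation

end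

open DirichletInterpolation

/-!
For `f` in `H²`, the sum `∑ (k + 1) |f̂(k)|²` is `‖f‖²_{H²}` plus the Dirichlet energy
`∑ k |f̂(k)|² = ‖f'‖²_{L²ₐ} = ⟨z f', f⟩_{H²}`, so both bounds are about the energy form.

*Upper bound.* The divided derivative `f^{(i)}(μ) / i!` is the `H²` inner product of `f` with
`z^i / (1 - \bar μ z)^{i + 1}`. Hence the orthogonal projection of `f` on the finite dimensional
space of the functions `p / ∏ (1 - \bar μ z)`, `deg p < card σ`, has the trace of `f` on `σ`
(`exists_interpolant`). Its `H²` norm is at most that of `f`, and the Bernstein inequality bounds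
its energy.
The Bernstein constant is estimated in `re_inner_euler_le` by induction on the number of poles.
Write `f = α k_l + b g` with `k_l` the Szegő kernel and `b` the Blaschke factor of a pole, and put
`u = g / (1 - \bar l z)`. The two summands are orthogonal in `H²`, multiplication by `b` is an
isometry of `H²`, and it increases the energy by exactly `(1 - |l|²) ‖u‖²`, at most
`(1 + r) / (1 - r) ‖g‖²` (`inner_euler_blaschke`). The mixed term of the energy is of size
`r / (1 - r²)`; it costs a two-by-two eigenvalue estimate (`bernstein_step`), which the
term `√n / (1 - r)` in the bound absorbs.

*Lower bound.* The same identity shows that the powers of `B = ω b_λ`, `|ω| = 1`, are orthogonal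
for the energy form, with `B ^ j` of energy `j`. Choose `ω` with `\bar λ = |λ| ω` and put
`h = ∑_{j < n} B ^ j`. The function `f = h / (1 - \bar λ z)` satisfies
`‖f‖² = n / (1 - |λ|²)`, and it is `h / (1 - |λ|)` up to multiples of `1` and `B ^ n`, which are
orthogonal to `h`. The functions `z (B ^ j)'`, `j < n`, are combinations of the kernels
representing the derivatives of order less than `n` at `λ`, so every `g` with the trace of `f` has
the same energy pairing with `h` as `f`, and the Cauchy-Schwarz inequality gives
`I(σ_{n,λ})² ≥ (n - 1) (1 + |λ|) / (2 (1 - |λ|))` (`le_interpConst_replicate`). This implies both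
lower bounds of the theorem.

All of this is done on Taylor coefficients, in an algebra of power series with rapidly decreasing
coefficients that contains all the functions involved except the given `f`, `g`.
-/

noncomputable section

namespace DirichletInterpolation
open scoped PowerSeries ComplexConjugate

/-! ### Taylor coefficients -/

theorem taylorCoeff_eq_of_hasSum {f : ℂ → ℂ} {c : ℕ → ℂ}
    (h : ∀ z ∈ disc, HasSum (fun k => c k * z ^ k) (f z)) (k : ℕ) : taylorCoeff f k = c k := by
  have h1 : HasFPowerSeriesAt f (FormalMultilinearSeries.ofScalars ℂ c) 0 := by
    rw [hasFPowerSeriesAt_iff]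
    filter_upwards [Metric.ball_mem_nhds (0 : ℂ) one_pos] with z hz
    simpa [FormalMultilinearSeries.coeff_ofScalars, mul_comm] using h z hz
  have h2 := h1.analyticAt.hasFPowerSeriesAt
  have h3 := h1.eq_formalMultilinearSeries h2
  rw [FormalMultilinearSeries.ofScalars_series_injective ℂ ℂ h3]
  rfl

theorem hol_of_hasSum {f : ℂ → ℂ} {c : ℕ → ℂ}
    (h : ∀ z ∈ disc, HasSum (fun k => c k * z ^ k) (f z)) : Hol f := by
  have h1 : HasFPowerSeriesOnBall f (FormalMultilinearSeries.ofScalars ℂ c) 0 1 := by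
    refine ⟨?_, one_pos, ?_⟩
    · refine le_of_forall_lt_imp_le_of_dense fun a ha => ?_
      lift a to NNReal using ha.ne_top
      refine FormalMultilinearSeries.le_radius_of_tendsto (l := 0) _ ?_
      have h2 := (h (a : ℂ) (by simpa [disc] using ha)).summable.tendsto_atTop_zero.norm
      simpa using h2
    · intro y hy
      have hy' : y ∈ disc := by
        simpa [disc, ← Metric.eball_ofReal] using hy
      have := h y hy'
      simpa [FormalMultilinearSeries.ofScalars_apply_eq, mul_comm] using this
  have h2 := h1.differentiableOn
  refine h2.mono ?_
  rw [← ENNReal.ofReal_one, Metric.eball_ofReal]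
  exact subset_rfl

theorem taylorCoeff_congr {f g : ℂ → ℂ} (h : ∀ z ∈ disc, f z = g z) (k : ℕ) :
    taylorCoeff f k = taylorCoeff g k := by
  have : f =ᶠ[𝓝 0] g := by
    filter_upwards [Metric.ball_mem_nhds (0 : ℂ) one_pos] with z hz using h z hz
  rw [taylorCoeff, taylorCoeff, this.iteratedDeriv_eq]

theorem hasSum_taylorCoeff {f : ℂ → ℂ} (hf : Hol f) {z : ℂ} (hz : z ∈ disc) :
    HasSum (fun k => taylorCoeff f k * z ^ k) (f z) := by
  have := Complex.hasSum_taylorSeries_on_ball hf hz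
  refine this.congr_fun fun k => ?_
  simp [taylorCoeff, div_eq_mul_inv]
  ring

theorem Hol.iteratedDeriv {f : ℂ → ℂ} (hf : Hol f) (i : ℕ) : Hol (iteratedDeriv i f) := by
  induction i with
  | zero => simpa using hf
  | succ i ih =>
    rw [iteratedDeriv_succ]
    exact DifferentiableOn.deriv ih Metric.isOpen_ball

theorem taylorCoeff_iteratedDeriv (f : ℂ → ℂ) (i k : ℕ) :
    taylorCoeff (iteratedDeriv i f) k
      = (i.factorial : ℂ) * ((k + i).choose i * taylorCoeff f (k + i)) := by
  have h1 : iteratedDeriv k (iteratedDeriv i f) = iteratedDeriv (k + i) f := by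
    rw [iteratedDeriv_eq_iterate, iteratedDeriv_eq_iterate, iteratedDeriv_eq_iterate,
      Function.iterate_add_apply]
  have h2 : ((k + i).choose i : ℂ) * i.factorial * k.factorial = (k + i).factorial := by
    have := Nat.add_choose_mul_factorial_mul_factorial k i
    exact_mod_cast (by rw [← this]; ring : (k + i).choose i * i.factorial * k.factorial = _)
  rw [taylorCoeff, taylorCoeff, h1, ← h2]
  have h3 : ((k + i).choose i : ℂ) ≠ 0 := by
    exact_mod_cast (Nat.choose_pos (Nat.le_add_left i k)).ne'
  have := Nat.factorial_ne_zero
  field_simp [this]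

/-- Taylor expansion at the origin of the divided derivatives of `f`. -/
theorem hasSum_iteratedDeriv {f : ℂ → ℂ} (hf : Hol f) {z : ℂ} (hz : z ∈ disc) (i : ℕ) :
    HasSum (fun k => taylorCoeff f (k + i) * ((k + i).choose i * z ^ k))
      (iteratedDeriv i f z / i.factorial) := by
  have h := (hasSum_taylorCoeff (hf.iteratedDeriv i) hz).div_const (i.factorial : ℂ)
  refine h.congr_fun fun k => ?_
  rw [taylorCoeff_iteratedDeriv]
  have : (i.factorial : ℂ) ≠ 0 := by exact_mod_cast i.factorial_ne_zero
  field_simp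

/-! ### Power series with rapidly decreasing coefficients -/

theorem summable_weight_mul (m : ℕ) {φ ψ : ℂ⟦X⟧}
    (hφ : Summable fun k : ℕ => ((k : ℝ) + 1) ^ m * ‖φ.coeff k‖)
    (hψ : Summable fun k : ℕ => ((k : ℝ) + 1) ^ m * ‖ψ.coeff k‖) :
    Summable fun k : ℕ => ((k : ℝ) + 1) ^ m * ‖(φ * ψ).coeff k‖ := by
  have h1 := summable_sum_mul_antidiagonal_of_summable_mul
    (f := fun k : ℕ => ((k : ℝ) + 1) ^ m * ‖φ.coeff k‖)
    (g := fun k : ℕ => ((k : ℝ) + 1) ^ m * ‖ψ.coeff k‖)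
    (hφ.mul_of_nonneg hψ (fun k => by positivity) (fun k => by positivity))
  refine Summable.of_nonneg_of_le (fun k => by positivity) (fun k => ?_) h1
  rw [PowerSeries.coeff_mul]
  refine (mul_le_mul_of_nonneg_left (norm_sum_le _ _) (by positivity)).trans ?_
  rw [Finset.mul_sum]
  refine Finset.sum_le_sum fun x hx => ?_
  rw [norm_mul]
  have hk : (k : ℝ) + 1 ≤ ((x.1 : ℝ) + 1) * ((x.2 : ℝ) + 1) := by
    have : (k : ℝ) = x.1 + x.2 := by
      exact_mod_cast (Finset.HasAntidiagonal.mem_antidiagonal.mp hx).symm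
    nlinarith [mul_nonneg (Nat.cast_nonneg (α := ℝ) x.1) (Nat.cast_nonneg (α := ℝ) x.2)]
  calc ((k : ℝ) + 1) ^ m * (‖φ.coeff x.1‖ * ‖ψ.coeff x.2‖)
      ≤ (((x.1 : ℝ) + 1) * ((x.2 : ℝ) + 1)) ^ m * (‖φ.coeff x.1‖ * ‖ψ.coeff x.2‖) := by gcongr
    _ = _ := by rw [mul_pow]; ring

theorem summable_weight_coe (m : ℕ) (p : Polynomial ℂ) :
    Summable fun k : ℕ => ((k : ℝ) + 1) ^ m * ‖(p : ℂ⟦X⟧).coeff k‖ := by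
  refine summable_of_ne_finset_zero (s := p.support) fun k hk => ?_
  simp [Polynomial.notMem_support_iff.mp hk]

/-- The algebra of power series whose coefficients decrease faster than every power of the index;
equivalently, the holomorphic functions on the disc that extend smoothly to its closure. Every
rational function without poles in the closed disc has its Taylor series here, all series below
converge absolutely here, and the algebra is stable under products and under the operator
`z d/dz`. -/
def smoothAlgebra : Subalgebra ℂ ℂ⟦X⟧ where
  carrier := {φ | ∀ m : ℕ, Summable fun k : ℕ => ((k : ℝ) + 1) ^ m * ‖φ.coeff k‖}
  mul_mem' hφ hψ m := summable_weight_mul m (hφ m) (hψ m)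
  add_mem' {φ ψ} hφ hψ m := by
    refine Summable.of_nonneg_of_le (fun k => by positivity) (fun k => ?_) ((hφ m).add (hψ m))
    rw [map_add, ← mul_add]
    exact mul_le_mul_of_nonneg_left (norm_add_le _ _) (by positivity)
  algebraMap_mem' c m := by
    simpa [PowerSeries.algebraMap_apply] using summable_weight_coe m (Polynomial.C c)

/-- The elements of `smoothAlgebra`. -/
abbrev SmoothSeries : Type := smoothAlgebra

namespace SmoothSeries

/-- The coefficients of a smooth series. -/
def cf (φ : SmoothSeries) (k : ℕ) : ℂ := (φ : ℂ⟦X⟧).coeff k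

theorem summable_norm (φ : SmoothSeries) : Summable fun k => ‖φ.cf k‖ := by
  simpa [cf] using φ.2 0

theorem ext_cf {φ ψ : SmoothSeries} (h : ∀ k, φ.cf k = ψ.cf k) : φ = ψ :=
  Subtype.ext (PowerSeries.ext h)

/-- A polynomial as a smooth series. -/
def ofPoly : Polynomial ℂ →ₐ[ℂ] SmoothSeries :=
  (Polynomial.coeToPowerSeries.algHom ℂ).codRestrict smoothAlgebra
    fun p m => by simpa using summable_weight_coe m p

theorem coe_ofPoly (p : Polynomial ℂ) : (ofPoly p : ℂ⟦X⟧) = p := rfl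

@[simp] theorem cf_ofPoly (p : Polynomial ℂ) (k : ℕ) : (ofPoly p).cf k = p.coeff k := by
  simp [coe_ofPoly, cf]

/-- The variable. -/
def var : SmoothSeries := ofPoly Polynomial.X

@[simp] theorem cf_add (φ ψ : SmoothSeries) (k : ℕ) : (φ + ψ).cf k = φ.cf k + ψ.cf k := by
  simp [cf]

@[simp] theorem cf_smul (c : ℂ) (φ : SmoothSeries) (k : ℕ) : (c • φ).cf k = c * φ.cf k := by
  simp [cf]

theorem coe_var : (var : ℂ⟦X⟧) = PowerSeries.X := by
  simp [var, coe_ofPoly]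

@[simp] theorem cf_var_mul_zero (φ : SmoothSeries) : (var * φ).cf 0 = 0 := by
  simp [cf, coe_var]

@[simp] theorem cf_var_mul_succ (φ : SmoothSeries) (k : ℕ) : (var * φ).cf (k + 1) = φ.cf k := by
  simp [cf, coe_var, PowerSeries.coeff_succ_X_mul]

theorem cf_var_pow_mul_add (φ : SmoothSeries) (i k : ℕ) : (var ^ i * φ).cf (k + i) = φ.cf k := by
  induction i with
  | zero => simp
  | succ i ih => rw [pow_succ', mul_assoc, ← add_assoc, cf_var_mul_succ, ih]

theorem cf_var_pow_mul_of_lt (φ : SmoothSeries) {i k : ℕ} (h : k < i) :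
    (var ^ i * φ).cf k = 0 := by
  induction i generalizing k with
  | zero => omega
  | succ i ih =>
    rw [pow_succ', mul_assoc]
    cases k with
    | zero => simp
    | succ k => rw [cf_var_mul_succ, ih (by omega)]

/-- The operator `z d/dz`. -/
def euler : SmoothSeries →ₗ[ℂ] SmoothSeries where
  toFun φ := ⟨PowerSeries.mk fun k => k * φ.cf k, fun m => by
    refine Summable.of_nonneg_of_le (fun k => by positivity) (fun k => ?_) (φ.2 (m + 1))
    rw [PowerSeries.coeff_mk, norm_mul, pow_succ, mul_assoc, Complex.norm_natCast]
    gcongr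
    · simp
    · exact le_rfl⟩
  map_add' φ ψ := ext_cf fun k => by simp [cf, mul_add]
  map_smul' c φ := ext_cf fun k => by simp [cf]; ring

@[simp] theorem cf_euler (φ : SmoothSeries) (k : ℕ) : (euler φ).cf k = k * φ.cf k := by
  simp [euler, cf]

theorem coe_euler (φ : SmoothSeries) :
    (euler φ : ℂ⟦X⟧) = PowerSeries.X * PowerSeries.derivative ℂ (φ : ℂ⟦X⟧) := by
  ext k
  change (euler φ).cf k = _
  rw [cf_euler]
  cases k with
  | zero => simp
  | succ k =>
    rw [PowerSeries.coeff_succ_X_mul, PowerSeries.coeff_derivative, mul_comm, cf]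
    push_cast
    rfl

theorem euler_mul (φ ψ : SmoothSeries) : euler (φ * ψ) = euler φ * ψ + φ * euler ψ := by
  apply Subtype.ext
  simp only [coe_euler, Subalgebra.coe_mul, Subalgebra.coe_add, Derivation.leibniz, smul_eq_mul]
  ring

@[simp] theorem euler_one : euler 1 = 0 := by
  apply Subtype.ext
  simp [coe_euler]

theorem euler_var : euler var = var := by
  apply Subtype.ext
  simp [coe_euler, coe_var]

theorem euler_pow (φ : SmoothSeries) (k : ℕ) :
    euler (φ ^ (k + 1)) = ((k : ℂ) + 1) • (φ ^ k * euler φ) := by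
  induction k with
  | zero => simp
  | succ k ih =>
    rw [pow_succ, euler_mul, ih]
    push_cast
    simp only [Algebra.smul_def, pow_succ, map_add, map_one]
    ring

/-! ### The Szegő kernels -/

/-- The Szegő kernel `1 / (1 - \bar l z)` at the point `l` of the disc. -/
def szego (l : ℂ) (hl : ‖l‖ < 1) : SmoothSeries :=
  ⟨PowerSeries.mk fun k => conj l ^ k, fun m => by
    have h0 : ‖(‖l‖ : ℝ)‖ < 1 := by simpa using hl
    have h : Summable fun k : ℕ => ((2 : ℝ) ^ m) * ((k : ℝ) ^ m * ‖l‖ ^ k + ‖l‖ ^ k) :=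
      ((summable_pow_mul_geometric_of_norm_lt_one m h0).add
        (summable_geometric_of_lt_one (norm_nonneg l) hl)).mul_left _
    refine Summable.of_nonneg_of_le (fun k => by positivity) (fun k => ?_) h
    rw [PowerSeries.coeff_mk, norm_pow, RCLike.norm_conj, ← add_one_mul, ← mul_assoc]
    gcongr
    rcases Nat.eq_zero_or_pos k with rfl | hk
    · simp only [CharP.cast_eq_zero, zero_add, one_pow]
      nlinarith [one_le_pow₀ (n := m) (one_le_two (α := ℝ)), pow_nonneg (le_refl (0 : ℝ)) m]
    · have hk' : (1 : ℝ) ≤ k := by exact_mod_cast hk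
      calc ((k : ℝ) + 1) ^ m ≤ (2 * k) ^ m := by gcongr; linarith
        _ = 2 ^ m * (k : ℝ) ^ m := mul_pow _ _ _
        _ ≤ 2 ^ m * ((k : ℝ) ^ m + 1) := by gcongr; linarith⟩

variable {l : ℂ} {hl : ‖l‖ < 1}

@[simp] theorem cf_szego (k : ℕ) : (szego l hl).cf k = conj l ^ k := by
  simp [szego, cf]

theorem szego_mul : szego l hl * (1 - conj l • var) = 1 := by
  have h : szego l hl = 1 + conj l • (var * szego l hl) := by
    refine ext_cf fun k => ?_
    cases k with
    | zero => simp [show (1 : SmoothSeries).cf 0 = 1 by simp [cf]]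
    | succ k =>
      simp [show (1 : SmoothSeries).cf (k + 1) = 0 by simp [cf, PowerSeries.coeff_one], pow_succ']
  have h2 : szego l hl * (1 - conj l • var)
      = szego l hl - conj l • (var * szego l hl) := by
    rw [mul_sub, mul_one, mul_smul_comm, mul_comm var]
  rw [h2]
  nth_rewrite 1 [h]
  ring

theorem cf_szego_pow (i k : ℕ) :
    (szego l hl ^ (i + 1)).cf k = (k + i).choose i * conj l ^ k := by
  have h : (szego l hl : ℂ⟦X⟧) = PowerSeries.rescale (conj l) (PowerSeries.mk 1) := by
    ext k
    simp [szego]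
  rw [cf, Subalgebra.coe_pow, h, ← map_pow, PowerSeries.mk_one_pow_eq_mk_choose_add]
  simp [add_comm, mul_comm]

theorem euler_szego :
    euler (szego l hl) = conj l • (var * szego l hl ^ 2) := by
  have h := congrArg euler (szego_mul (l := l) (hl := hl))
  simp only [euler_mul, euler_one, map_sub, map_smul, euler_var] at h
  have h2 := szego_mul (l := l) (hl := hl)
  simp only [Algebra.smul_def] at *
  linear_combination szego l hl * h - (euler (szego l hl)) * h2

/-! ### The Hilbert space of square summable coefficients -/

/-- The coefficient space of `H²`. -/
abbrev CoeffSpace := lp (fun _ : ℕ => ℂ) 2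

theorem memlp_cf (φ : SmoothSeries) : Memℓp φ.cf 2 := by
  refine (memℓp_gen (p := 1) ?_ : Memℓp φ.cf 1).of_exponent_ge (by norm_num)
  simpa using φ.summable_norm

/-- The coefficient sequence of a smooth series, as a vector of the Hilbert space. -/
def toCoeff : SmoothSeries →ₗ[ℂ] CoeffSpace where
  toFun φ := ⟨φ.cf, φ.memlp_cf⟩
  map_add' φ ψ := by ext k; exact cf_add φ ψ k
  map_smul' c φ := by ext k; exact cf_smul c φ k

@[simp] theorem toCoeff_apply (φ : SmoothSeries) (k : ℕ) : toCoeff φ k = φ.cf k := rfl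

theorem inner_coe_eq (a b : CoeffSpace) : inner ℂ a b = ∑' k, b k * conj (a k) := by
  rw [lp.inner_eq_tsum]
  simp [RCLike.inner_apply]

theorem inner_var_mul (φ ψ : SmoothSeries) :
    inner ℂ (toCoeff (var * φ)) (toCoeff (var * ψ)) = inner ℂ (toCoeff φ) (toCoeff ψ) := by
  rw [inner_coe_eq, inner_coe_eq]
  rw [Summable.tsum_eq_zero_add]
  · simp
  · have := lp.summable_inner (𝕜 := ℂ) (toCoeff (var * φ)) (toCoeff (var * ψ))
    simpa [RCLike.inner_apply] using this

theorem norm_var_mul (φ : SmoothSeries) : ‖toCoeff (var * φ)‖ = ‖toCoeff φ‖ := by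
  rw [@norm_eq_sqrt_re_inner ℂ, @norm_eq_sqrt_re_inner ℂ, inner_var_mul]

theorem inner_euler_left (φ ψ : SmoothSeries) :
    inner ℂ (toCoeff (euler φ)) (toCoeff ψ) = inner ℂ (toCoeff φ) (toCoeff (euler ψ)) := by
  rw [inner_coe_eq, inner_coe_eq]
  refine tsum_congr fun k => ?_
  simp
  ring

/-- The powers of the Szegő kernel represent the divided derivatives at the point `l`. -/
theorem inner_szego_pow {f : ℂ → ℂ} (hf : Hol f) (a : CoeffSpace)
    (ha : ∀ k, a k = taylorCoeff f k) (i : ℕ) :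
    inner ℂ (toCoeff (var ^ i * szego l hl ^ (i + 1))) a = iteratedDeriv i f l / i.factorial := by
  have hd : l ∈ disc := by simpa [disc] using hl
  have hs : Summable fun k => a k * conj ((toCoeff (var ^ i * szego l hl ^ (i + 1))) k) := by
    have := lp.summable_inner (𝕜 := ℂ) (toCoeff (var ^ i * szego l hl ^ (i + 1))) a
    simpa [RCLike.inner_apply] using this
  rw [← (hasSum_iteratedDeriv hf hd i).tsum_eq, inner_coe_eq, ← hs.sum_add_tsum_nat_add i,
    Finset.sum_eq_zero, zero_add]
  · refine tsum_congr fun k => ?_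
    rw [toCoeff_apply, cf_var_pow_mul_add, cf_szego_pow, ha]
    simp
  · intro k hk
    rw [toCoeff_apply, cf_var_pow_mul_of_lt _ (Finset.mem_range.mp hk)]
    simp

/-! ### The function defined by a smooth series -/

/-- The function on the disc defined by a smooth series. -/
def toFun (φ : SmoothSeries) (z : ℂ) : ℂ := ∑' k, φ.cf k * z ^ k

theorem summable_norm_mul_pow (φ : SmoothSeries) {z : ℂ} (hz : z ∈ disc) :
    Summable fun k => ‖φ.cf k * z ^ k‖ := by
  refine Summable.of_nonneg_of_le (fun k => by positivity) (fun k => ?_) φ.summable_norm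
  rw [norm_mul, norm_pow]
  have : ‖z‖ ≤ 1 := by simpa [disc] using (mem_ball_zero_iff.mp hz).le
  exact mul_le_of_le_one_right (norm_nonneg _) (pow_le_one₀ (norm_nonneg _) this)

theorem hasSum_toFun (φ : SmoothSeries) {z : ℂ} (hz : z ∈ disc) :
    HasSum (fun k => φ.cf k * z ^ k) (φ.toFun z) :=
  (φ.summable_norm_mul_pow hz).of_norm.hasSum

theorem hol_toFun (φ : SmoothSeries) : Hol φ.toFun :=
  hol_of_hasSum fun _ hz => φ.hasSum_toFun hz

theorem taylorCoeff_toFun (φ : SmoothSeries) (k : ℕ) : taylorCoeff φ.toFun k = φ.cf k :=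
  taylorCoeff_eq_of_hasSum (fun _ hz => φ.hasSum_toFun hz) k

theorem toFun_mul (φ ψ : SmoothSeries) {z : ℂ} (hz : z ∈ disc) :
    (φ * ψ).toFun z = φ.toFun z * ψ.toFun z := by
  rw [toFun, toFun, toFun, tsum_mul_tsum_eq_tsum_sum_antidiagonal_of_summable_norm
    (φ.summable_norm_mul_pow hz) (ψ.summable_norm_mul_pow hz)]
  refine tsum_congr fun k => ?_
  rw [cf, Subalgebra.coe_mul, PowerSeries.coeff_mul, Finset.sum_mul]
  refine Finset.sum_congr rfl fun x hx => ?_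
  rw [← Finset.HasAntidiagonal.mem_antidiagonal.mp hx, pow_add, cf, cf]
  ring

theorem toFun_ofPoly (p : Polynomial ℂ) (z : ℂ) : (ofPoly p).toFun z = p.eval z := by
  rw [toFun, Polynomial.eval_eq_sum, Polynomial.sum, tsum_eq_sum (s := p.support)]
  · simp
  · intro k hk
    simp [Polynomial.notMem_support_iff.mp hk]

/-- The Taylor series of a rational function without poles in the disc. -/
theorem taylorCoeff_div {φ : SmoothSeries} {p q : Polynomial ℂ} (h : φ * ofPoly q = ofPoly p)
    (hq : ∀ z ∈ disc, q.eval z ≠ 0) (k : ℕ) :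
    taylorCoeff (fun z => p.eval z / q.eval z) k = φ.cf k := by
  rw [← taylorCoeff_toFun]
  refine taylorCoeff_congr (fun z hz => ?_) k
  rw [div_eq_iff (hq z hz), ← toFun_ofPoly q, ← toFun_mul _ _ hz, h, toFun_ofPoly]

theorem hol_div {p q : Polynomial ℂ} (hq : ∀ z ∈ disc, q.eval z ≠ 0) :
    Hol (fun z => p.eval z / q.eval z) :=
  DifferentiableOn.div p.differentiable.differentiableOn q.differentiable.differentiableOn hq

/-! ### Multiplication by a Blaschke factor -/

theorem euler_var_mul (u : SmoothSeries) : euler (var * u) = var * u + var * euler u := by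
  rw [euler_mul, euler_var]

theorem conj_mul_self_eq (l : ℂ) : conj l * l = (‖l‖ : ℂ) ^ 2 := Complex.conj_mul' l

/-- Both sides are the products of `u`, `v` with functions of the same modulus on the circle. -/
theorem inner_blaschke (l : ℂ) (u v : SmoothSeries) :
    inner ℂ (toCoeff (var * u - l • u)) (toCoeff (var * v - l • v))
      = inner ℂ (toCoeff (u - conj l • (var * u))) (toCoeff (v - conj l • (var * v))) := by
  simp only [map_sub, map_smul, inner_sub_left, inner_sub_right, inner_smul_left, inner_smul_right,
    inner_var_mul, RCLike.conj_conj]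
  ring

/-- The Dirichlet form grows under multiplication by the Blaschke factor
`(z - l) / (1 - \bar l z)`, and the growth is an explicit multiple of the Hardy form. Here
`u`, `v` are the quotients by `1 - \bar l z`. -/
theorem inner_euler_blaschke (l : ℂ) (u v : SmoothSeries) :
    inner ℂ (toCoeff (euler (var * u - l • u))) (toCoeff (var * v - l • v))
      = inner ℂ (toCoeff (euler (u - conj l • (var * u)))) (toCoeff (v - conj l • (var * v)))
        + (1 - (‖l‖ : ℂ) ^ 2) * inner ℂ (toCoeff u) (toCoeff v) := by
  rw [← conj_mul_self_eq]
  simp only [map_sub, map_smul, inner_sub_left, inner_sub_right, inner_smul_left, inner_smul_right,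
    inner_var_mul, RCLike.conj_conj, euler_var_mul, map_add, inner_add_left]
  ring

theorem inner_one_left (φ : SmoothSeries) : inner ℂ (toCoeff 1) (toCoeff φ) = φ.cf 0 := by
  rw [inner_coe_eq, tsum_eq_single 0]
  · simp [cf]
  · intro k hk
    simp [cf, PowerSeries.coeff_one, hk]

theorem szego_eq : szego l hl = 1 + conj l • (var * szego l hl) := by
  have h := szego_mul (l := l) (hl := hl)
  rw [mul_sub, mul_one, mul_smul_comm, mul_comm _ var] at h
  rw [← h]
  ring

/-- The pairing with the Szegő kernel is evaluation at `l`, so it turns multiplication by the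
variable into multiplication by `l`. -/
theorem inner_szego_var_mul (φ : SmoothSeries) :
    inner ℂ (toCoeff (szego l hl)) (toCoeff (var * φ))
      = l * inner ℂ (toCoeff (szego l hl)) (toCoeff φ) := by
  nth_rewrite 1 [szego_eq]
  simp only [map_add, map_smul, inner_add_left, inner_smul_left, inner_var_mul, inner_one_left,
    RCLike.conj_conj, cf_var_mul_zero, zero_add]

theorem one_sub_normSq_pos (hl : ‖l‖ < 1) : 0 < 1 - ‖l‖ ^ 2 := by
  nlinarith [norm_nonneg l]

theorem inner_szego_self :
    inner ℂ (toCoeff (szego l hl)) (toCoeff (szego l hl)) = (((1 - ‖l‖ ^ 2)⁻¹ : ℝ) : ℂ) := by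
  have h : inner ℂ (toCoeff (szego l hl)) (toCoeff (szego l hl))
      = 1 + conj l * (l * inner ℂ (toCoeff (szego l hl)) (toCoeff (szego l hl))) := by
    have h1 : inner ℂ (toCoeff (szego l hl)) (toCoeff 1) = 1 := by
      rw [← inner_conj_symm, inner_one_left]
      simp
    conv_lhs => rw [szego_eq (l := l) (hl := hl)]
    rw [← szego_eq, ← inner_szego_var_mul]
    conv_lhs => arg 3; rw [szego_eq (l := l) (hl := hl)]
    rw [map_add, map_smul, inner_add_right, inner_smul_right, h1]
  rw [← mul_assoc, conj_mul_self_eq] at h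
  have hp : ((1 - ‖l‖ ^ 2 : ℝ) : ℂ) ≠ 0 := by exact_mod_cast (one_sub_normSq_pos hl).ne'
  rw [Complex.ofReal_inv]
  refine eq_inv_of_mul_eq_one_left ?_
  push_cast
  linear_combination h

theorem inner_szego_blaschke (u : SmoothSeries) :
    inner ℂ (toCoeff (szego l hl)) (toCoeff (var * u - l • u)) = 0 := by
  rw [map_sub, map_smul, inner_sub_right, inner_smul_right, inner_szego_var_mul, sub_self]

theorem inner_szego_euler_blaschke (u : SmoothSeries) :
    inner ℂ (toCoeff (szego l hl)) (toCoeff (euler (var * u - l • u)))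
      = l * inner ℂ (toCoeff (szego l hl)) (toCoeff u) := by
  rw [map_sub, map_smul, euler_var_mul, map_sub, map_add, map_smul, inner_sub_right,
    inner_add_right, inner_smul_right, inner_szego_var_mul, inner_szego_var_mul]
  ring

theorem inner_euler_szego_self :
    inner ℂ (toCoeff (euler (szego l hl))) (toCoeff (szego l hl))
      = ((‖l‖ ^ 2 * (1 - ‖l‖ ^ 2)⁻¹ ^ 2 : ℝ) : ℂ) := by
  set k := szego l hl with hk
  have hp : ((1 - ‖l‖ ^ 2 : ℝ) : ℂ) ≠ 0 := by exact_mod_cast (one_sub_normSq_pos hl).ne'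
  have h : inner ℂ (toCoeff k) (toCoeff (euler k))
      = conj l * (l * (inner ℂ (toCoeff k) (toCoeff k)
        + inner ℂ (toCoeff k) (toCoeff (euler k)))) := by
    conv_lhs => arg 3; rw [hk, szego_eq (l := l) (hl := hl)]
    rw [← hk, map_add, euler_one, zero_add, map_smul, euler_var_mul, map_smul, map_add,
      inner_smul_right, inner_add_right, hk, inner_szego_var_mul, inner_szego_var_mul]
    ring
  rw [inner_euler_left]
  rw [← mul_assoc, conj_mul_self_eq, hk, inner_szego_self, ← hk] at h
  push_cast at *
  field_simp at h ⊢
  linear_combination h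

/-! ### The Bernstein inequality -/

theorem norm_le_of_sub_smul_var_mul (u : SmoothSeries) :
    (1 - ‖l‖) * ‖toCoeff u‖ ≤ ‖toCoeff (u - conj l • (var * u))‖ := by
  have h := norm_sub_norm_le (toCoeff u) (toCoeff (conj l • (var * u)))
  rw [map_smul, norm_smul, norm_var_mul, RCLike.norm_conj] at h
  rw [map_sub, map_smul]
  linarith

theorem inner_szego_sub (u : SmoothSeries) :
    inner ℂ (toCoeff (szego l hl)) (toCoeff (u - conj l • (var * u)))
      = (1 - (‖l‖ : ℂ) ^ 2) * inner ℂ (toCoeff (szego l hl)) (toCoeff u) := by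
  rw [map_sub, map_smul, inner_sub_right, inner_smul_right, inner_szego_var_mul,
    ← conj_mul_self_eq]
  ring

theorem normSq_szego : ‖toCoeff (szego l hl)‖ ^ 2 = (1 - ‖l‖ ^ 2)⁻¹ := by
  rw [← Complex.ofReal_inj, ← inner_szego_self (hl := hl)]
  rw [inner_self_eq_norm_sq_to_K]
  simp

theorem normSq_szego_add (α : ℂ) (u : SmoothSeries) :
    ‖toCoeff (α • szego l hl + (var * u - l • u))‖ ^ 2
      = ‖α‖ ^ 2 * (1 - ‖l‖ ^ 2)⁻¹ + ‖toCoeff (u - conj l • (var * u))‖ ^ 2 := by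
  have h1 : ‖toCoeff (var * u - l • u)‖ = ‖toCoeff (u - conj l • (var * u))‖ := by
    rw [@norm_eq_sqrt_re_inner ℂ, @norm_eq_sqrt_re_inner ℂ, inner_blaschke]
  have h2 : inner ℂ (α • toCoeff (szego l hl)) (toCoeff (var * u - l • u)) = 0 := by
    rw [inner_smul_left, inner_szego_blaschke, mul_zero]
  rw [map_add, map_smul, @norm_add_sq ℂ, h2, norm_smul, mul_pow, normSq_szego, h1]
  simp

theorem re_inner_euler_szego_add_le (α : ℂ) (u : SmoothSeries) :
    (inner ℂ (toCoeff (euler (α • szego l hl + (var * u - l • u))))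
        (toCoeff (α • szego l hl + (var * u - l • u)))).re
      ≤ ‖α‖ ^ 2 * (‖l‖ ^ 2 * (1 - ‖l‖ ^ 2)⁻¹ ^ 2)
        + 2 * (‖α‖ * (‖l‖ * ‖inner ℂ (toCoeff (szego l hl)) (toCoeff u)‖))
        + ((inner ℂ (toCoeff (euler (u - conj l • (var * u))))
            (toCoeff (u - conj l • (var * u)))).re
          + (1 - ‖l‖ ^ 2) * ‖toCoeff u‖ ^ 2) := by
  set h := var * u - l • u with hh
  have e1 : inner ℂ (toCoeff (euler h)) (toCoeff h)
      = inner ℂ (toCoeff (euler (u - conj l • (var * u)))) (toCoeff (u - conj l • (var * u)))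
        + (((1 - ‖l‖ ^ 2) * ‖toCoeff u‖ ^ 2 : ℝ) : ℂ) := by
    rw [hh, inner_euler_blaschke, inner_self_eq_norm_sq_to_K]
    push_cast
    simp
  have e2 : inner ℂ (toCoeff (euler h)) (toCoeff (szego l hl))
      = conj (l * inner ℂ (toCoeff (szego l hl)) (toCoeff u)) := by
    rw [← inner_szego_euler_blaschke, inner_conj_symm]
  have e3 : inner ℂ (toCoeff (euler (szego l hl))) (toCoeff h)
      = l * inner ℂ (toCoeff (szego l hl)) (toCoeff u) := by
    rw [inner_euler_left, ← inner_szego_euler_blaschke]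
  have e4 : inner ℂ (toCoeff (euler (α • szego l hl + h))) (toCoeff (α • szego l hl + h))
      = ((‖α‖ ^ 2 * (‖l‖ ^ 2 * (1 - ‖l‖ ^ 2)⁻¹ ^ 2) : ℝ) : ℂ)
        + (conj α * (l * inner ℂ (toCoeff (szego l hl)) (toCoeff u))
          + conj (conj α * (l * inner ℂ (toCoeff (szego l hl)) (toCoeff u))))
        + inner ℂ (toCoeff (euler h)) (toCoeff h) := by
    have : ((‖α‖ ^ 2 : ℝ) : ℂ) = conj α * α := by rw [conj_mul_self_eq]; push_cast; rfl
    rw [Complex.ofReal_mul, this, ← inner_euler_szego_self (hl := hl)]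
    simp only [map_add, map_smul, inner_add_left, inner_add_right, inner_smul_left,
      inner_smul_right, e2, e3, map_mul, RCLike.conj_conj]
    ring
  rw [e4, e1]
  simp only [Complex.add_re, Complex.ofReal_re, Complex.conj_re]
  have h5 := Complex.re_le_norm (conj α * (l * inner ℂ (toCoeff (szego l hl)) (toCoeff u)))
  rw [norm_mul, norm_mul, RCLike.norm_conj] at h5
  linarith

/-- The largest eigenvalue estimate behind one step of the induction: a bound `n ρ + √n / (1 - r)`
with `ρ = (1 + r) / (1 - r)` increases enough from `n` to `n + 1` to absorb the off-diagonal
entries `r / (1 - r²)`. -/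
theorem bernstein_step {r x y : ℝ} (n : ℕ) (hr : 0 ≤ r) (hr1 : r < 1) :
    r ^ 2 / (1 - r ^ 2) * x ^ 2 + 2 * (r / (1 - r ^ 2)) * (x * y)
        + ((n * (1 + r) + √n) / (1 - r) + (1 + r) / (1 - r)) * y ^ 2
      ≤ (((n + 1 : ℕ) : ℝ) * (1 + r) + √((n + 1 : ℕ) : ℝ)) / (1 - r) * (x ^ 2 + y ^ 2) := by
  set m := √((n + 1 : ℕ) : ℝ) with hm
  set q := √(n : ℝ) with hq
  have hm2 : m ^ 2 = n + 1 := by rw [hm, Real.sq_sqrt (by positivity)]; push_cast; ring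
  have hq2 : q ^ 2 = n := by rw [hq, Real.sq_sqrt (by positivity)]
  have hq0 : 0 ≤ q := Real.sqrt_nonneg _
  have hm1 : 1 ≤ m := by
    rw [hm, Real.one_le_sqrt]
    simp
  have hqm : q ≤ m := Real.sqrt_le_sqrt (by simp)
  set s := r / (1 + r) with hs
  have hs0 : 0 ≤ s := by positivity
  have hs1 : s ≤ 1 / 2 := by rw [hs, div_le_div_iff₀ (by linarith) two_pos]; linarith
  have hsr : s ≤ 1 := by linarith
  have hd : 1 - r ≠ 0 := by linarith
  have hd' : 1 + r ≠ 0 := by linarith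
  have e1 : r / (1 - r ^ 2) = s / (1 - r) := by
    rw [hs, div_div, show (1 + r) * (1 - r) = 1 - r ^ 2 by ring]
  have e2 : r ^ 2 / (1 - r ^ 2) = r * s / (1 - r) := by
    rw [mul_div_assoc, ← e1]; ring
  have key : r * s * x ^ 2 + 2 * s * (x * y) ≤ (m ^ 2 * (1 + r) + m) * x ^ 2 + (m - q) * y ^ 2 := by
    -- `√(n + 1) - √n ≥ 1 / (2 √(n + 1))`, since `m ^ 2 - q ^ 2 = 1` and `q ≤ m`.
    have h1 : 1 ≤ 2 * m * (m - q) := by nlinarith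
    have h2 : 2 * m * (2 * s * (x * y)) ≤ 2 * m * (2 * s ^ 2 * m * x ^ 2) + y ^ 2 := by
      nlinarith [sq_nonneg (2 * m * s * x - y)]
    have h3 : r * s + 2 * s ^ 2 * m ≤ m ^ 2 * (1 + r) + m := by
      have : r * s ≤ r := mul_le_of_le_one_right hr hsr
      have : s ^ 2 ≤ 1 / 4 := by nlinarith
      have : r * 1 ≤ r * m ^ 2 := mul_le_mul_of_nonneg_left (by nlinarith) hr
      nlinarith
    have h4 : 2 * m * (r * s * x ^ 2 + 2 * s * (x * y))
        ≤ 2 * m * ((m ^ 2 * (1 + r) + m) * x ^ 2 + (m - q) * y ^ 2) := by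
      have := mul_le_mul_of_nonneg_right h3 (sq_nonneg x)
      have h6 := mul_le_mul_of_nonneg_left this (by linarith : 0 ≤ 2 * m)
      have := mul_le_mul_of_nonneg_right h1 (sq_nonneg y)
      nlinarith
    exact le_of_mul_le_mul_left h4 (by linarith)
  rw [e1, e2, ← sub_nonneg]
  have e3 : (((n + 1 : ℕ) : ℝ) * (1 + r) + m) / (1 - r) * (x ^ 2 + y ^ 2)
      - (r * s / (1 - r) * x ^ 2 + 2 * (s / (1 - r)) * (x * y)
        + ((n * (1 + r) + q) / (1 - r) + (1 + r) / (1 - r)) * y ^ 2)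
      = ((m ^ 2 * (1 + r) + m) * x ^ 2 + (m - q) * y ^ 2
        - (r * s * x ^ 2 + 2 * s * (x * y))) / (1 - r) := by
    rw [hm2]
    push_cast
    field_simp
    ring
  rw [e3]
  exact div_nonneg (by linarith) (by linarith)

/-- The polynomial `∏ (1 - \bar l z)` over the points `l` of `s`, whose zeros are the reflections
`1 / \bar l` of these points in the unit circle. -/
def den (s : Multiset ℂ) : Polynomial ℂ :=
  (s.map fun l => 1 - Polynomial.C (conj l) * Polynomial.X).prod

theorem den_cons (l : ℂ) (s : Multiset ℂ) :
    den (l ::ₘ s) = (1 - Polynomial.C (conj l) * Polynomial.X) * den s := by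
  simp [den]

theorem ofPoly_C_mul (c : ℂ) (p : Polynomial ℂ) : ofPoly (Polynomial.C c * p) = c • ofPoly p := by
  rw [← map_smul, Polynomial.smul_eq_C_mul]

theorem ofPoly_factor (l : ℂ) :
    ofPoly (1 - Polynomial.C (conj l) * Polynomial.X) = 1 - conj l • var := by
  rw [map_sub, map_one, ofPoly_C_mul, var]

theorem degree_factor_le (l : ℂ) : (1 - Polynomial.C l * Polynomial.X).degree ≤ 1 := by
  refine (Polynomial.degree_sub_le _ _).trans ?_
  rw [Polynomial.degree_one, max_le_iff]
  exact ⟨by norm_num, (Polynomial.degree_C_mul_X_le _)⟩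

theorem degree_den_le (s : Multiset ℂ) : (den s).degree ≤ (Multiset.card s : WithBot ℕ) := by
  induction s using Multiset.induction with
  | empty => simp [den]
  | cons l s ih =>
    rw [den_cons, Polynomial.degree_mul, Multiset.card_cons, add_comm]
    push_cast
    exact add_le_add ih (degree_factor_le _)

theorem eval_den_ne_zero {s : Multiset ℂ} {z : ℂ} (h : ∀ l ∈ s, ‖l‖ * ‖z‖ < 1) :
    (den s).eval z ≠ 0 := by
  rw [den, Polynomial.eval_multiset_prod, Multiset.map_map, Ne, Multiset.prod_eq_zero_iff,
    Multiset.mem_map]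
  rintro ⟨l, hl, h0⟩
  have h1 : (1 : ℂ) = conj l * z := by simpa [sub_eq_zero] using h0
  have h2 := congrArg norm h1
  rw [norm_mul, RCLike.norm_conj, norm_one] at h2
  linarith [h l hl]

theorem exists_mul_den_eq_one {s : Multiset ℂ} (hs : ∀ l ∈ s, ‖l‖ < 1) :
    ∃ κ : SmoothSeries, κ * ofPoly (den s) = 1 := by
  induction s using Multiset.induction with
  | empty => exact ⟨1, by simp [den]⟩
  | cons l s ih =>
    obtain ⟨κ, hκ⟩ := ih fun m hm => hs m (Multiset.mem_cons_of_mem hm)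
    refine ⟨szego l (hs l (Multiset.mem_cons_self l s)) * κ, ?_⟩
    rw [den_cons, map_mul, ofPoly_factor, mul_mul_mul_comm, szego_mul, hκ, one_mul]

/-- A polynomial of degree at most `card s` splits as `α * den s + (z - l) * p₁` with
`deg p₁ < card s`. -/
theorem exists_eq_add_mul {s : Multiset ℂ} {p : Polynomial ℂ} {l : ℂ}
    (hp : p.degree ≤ (Multiset.card s : WithBot ℕ)) (hl : (den s).eval l ≠ 0) :
    ∃ (α : ℂ) (p₁ : Polynomial ℂ), p₁.degree < (Multiset.card s : WithBot ℕ) ∧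
      p = Polynomial.C α * den s + (Polynomial.X - Polynomial.C l) * p₁ := by
  set α := p.eval l / (den s).eval l
  have hroot : (p - Polynomial.C α * den s).IsRoot l := by
    simp [α, hl]
  obtain ⟨p₁, hp₁⟩ := Polynomial.dvd_iff_isRoot.mpr hroot
  refine ⟨α, p₁, ?_, by rw [← hp₁]; ring⟩
  have hd : (p - Polynomial.C α * den s).degree ≤ (Multiset.card s : WithBot ℕ) := by
    refine (Polynomial.degree_sub_le _ _).trans (max_le hp ?_)
    rw [← Polynomial.smul_eq_C_mul]
    exact (Polynomial.degree_smul_le _ _).trans (degree_den_le s)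
  rw [hp₁, Polynomial.degree_mul, Polynomial.degree_X_sub_C] at hd
  rcases eq_or_ne p₁ 0 with rfl | h0
  · simp
  · rw [Polynomial.degree_eq_natDegree h0] at hd ⊢
    norm_cast at hd ⊢
    omega

/-- The Bernstein inequality `‖f'‖²_{L²ₐ} ≤ (n (1 + r) + √n) / (1 - r) ‖f‖²_{H²}` for
`f = p / den s`. -/
theorem re_inner_euler_le {r : ℝ} (hr : 0 ≤ r) (hr1 : r < 1) (s : Multiset ℂ)
    (hs : ∀ l ∈ s, ‖l‖ ≤ r) (φ : SmoothSeries) (p : Polynomial ℂ)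
    (hp : p.degree < (Multiset.card s : WithBot ℕ)) (h : φ * ofPoly (den s) = ofPoly p) :
    (inner ℂ (toCoeff (euler φ)) (toCoeff φ)).re
      ≤ ((Multiset.card s : ℝ) * (1 + r) + √(Multiset.card s : ℝ)) / (1 - r)
        * ‖toCoeff φ‖ ^ 2 := by
  induction s using Multiset.induction generalizing φ p with
  | empty =>
    have hp0 : p = 0 := by
      rw [← Polynomial.degree_eq_bot]
      simpa using hp
    have : φ = 0 := by simpa [den, hp0] using h
    simp [this]
  | cons l s ih =>
    have hlr : ‖l‖ ≤ r := hs l (Multiset.mem_cons_self l s)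
    have hl : ‖l‖ < 1 := hlr.trans_lt hr1
    have hs' : ∀ m ∈ s, ‖m‖ ≤ r := fun m hm => hs m (Multiset.mem_cons_of_mem hm)
    have hpd : p.degree ≤ (Multiset.card s : WithBot ℕ) := by
      rw [Multiset.card_cons] at hp
      rcases eq_or_ne p 0 with rfl | h0
      · simp
      · rw [Polynomial.degree_eq_natDegree h0] at hp ⊢
        norm_cast at hp ⊢
        omega
    have hev : (den s).eval l ≠ 0 := by
      refine eval_den_ne_zero fun m hm => ?_
      have := hs' m hm
      nlinarith [norm_nonneg l, norm_nonneg m]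
    obtain ⟨α, p₁, hp₁, rfl⟩ := exists_eq_add_mul hpd hev
    obtain ⟨κ, hκ⟩ := exists_mul_den_eq_one fun m hm => (hs' m hm).trans_lt hr1
    -- `g = p₁ / den s` is the quotient of the part vanishing at `l` by the Blaschke factor.
    set g := κ * ofPoly p₁ with hg
    set u := szego l hl * g with hu
    have hk := szego_mul (l := l) (hl := hl)
    have hgu : u - conj l • (var * u) = g := by
      rw [hu]
      simp only [Algebra.smul_def] at hk ⊢
      linear_combination g * hk
    have hφ : φ = α • szego l hl + (var * u - l • u) := by
      rw [den_cons, map_mul, ofPoly_factor, map_add, ofPoly_C_mul, map_mul, map_sub,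
        Polynomial.C_eq_algebraMap, AlgHom.commutes] at h
      change φ * ((1 - conj l • var) * ofPoly (den s))
        = α • ofPoly (den s) + (var - algebraMap ℂ SmoothSeries l) * ofPoly p₁ at h
      rw [hu, hg]
      simp only [Algebra.smul_def] at hk h ⊢
      linear_combination szego l hl * κ * h - φ * κ * ofPoly (den s) * hk - φ * hκ
        + algebraMap ℂ SmoothSeries α * szego l hl * hκ
    have hgD := ih hs' g p₁ hp₁ (by rw [hg, mul_right_comm, hκ, one_mul])
    have hD := re_inner_euler_szego_add_le (hl := hl) α u
    have hN := normSq_szego_add (hl := hl) α u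
    have hv := norm_le_of_sub_smul_var_mul (l := l) u
    have hE := norm_inner_le_norm (𝕜 := ℂ) (toCoeff (szego l hl)) (toCoeff g)
    rw [← hgu, inner_szego_sub, norm_mul, hgu] at hE
    rw [← hφ, hgu] at hD hN
    rw [hgu] at hv
    have hk2 := normSq_szego (l := l) (hl := hl)
    set ρ := ‖l‖ with hρ
    have hρ0 : 0 ≤ ρ := norm_nonneg l
    have hpos : 0 < 1 - ρ ^ 2 := one_sub_normSq_pos hl
    have hposr : 0 < 1 - r ^ 2 := by nlinarith
    set y := ‖toCoeff g‖
    set c := ‖toCoeff (szego l hl)‖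
    set e := ‖inner ℂ (toCoeff (szego l hl)) (toCoeff u)‖
    have hc1 : ‖(1 - (ρ : ℂ) ^ 2)‖ = 1 - ρ ^ 2 := by
      rw [← Complex.ofReal_pow, ← Complex.ofReal_one, ← Complex.ofReal_sub, Complex.norm_real,
        Real.norm_of_nonneg hpos.le]
    rw [hc1] at hE
    have hτ : ρ / (1 - ρ ^ 2) ≤ r / (1 - r ^ 2) :=
      div_le_div₀ hr hlr hposr (by nlinarith)
    have hτ2 : ρ ^ 2 / (1 - ρ ^ 2) ≤ r ^ 2 / (1 - r ^ 2) :=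
      div_le_div₀ (sq_nonneg r) (by gcongr) hposr (by nlinarith)
    have hxy : 0 ≤ ‖α‖ * c * y := by positivity
    have t1 : ‖α‖ ^ 2 * (ρ ^ 2 * (1 - ρ ^ 2)⁻¹ ^ 2) ≤ r ^ 2 / (1 - r ^ 2) * (‖α‖ * c) ^ 2 := by
      calc ‖α‖ ^ 2 * (ρ ^ 2 * (1 - ρ ^ 2)⁻¹ ^ 2) = ρ ^ 2 / (1 - ρ ^ 2) * (‖α‖ * c) ^ 2 := by
            rw [mul_pow, hk2]; ring
        _ ≤ _ := by gcongr
    have t2 : ‖α‖ * (ρ * e) ≤ r / (1 - r ^ 2) * (‖α‖ * c * y) := by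
      have : e ≤ c * y / (1 - ρ ^ 2) := by rw [le_div_iff₀ hpos]; linarith
      calc ‖α‖ * (ρ * e) ≤ ‖α‖ * (ρ * (c * y / (1 - ρ ^ 2))) := by gcongr
        _ = ρ / (1 - ρ ^ 2) * (‖α‖ * c * y) := by ring
        _ ≤ _ := by gcongr
    have t3 : (1 - ρ ^ 2) * ‖toCoeff u‖ ^ 2 ≤ (1 + r) / (1 - r) * y ^ 2 := by
      have h1 : 0 < 1 - ρ := by linarith
      have h2 : ‖toCoeff u‖ ≤ y / (1 - ρ) := by rw [le_div_iff₀ h1]; linarith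
      calc (1 - ρ ^ 2) * ‖toCoeff u‖ ^ 2 ≤ (1 - ρ ^ 2) * (y / (1 - ρ)) ^ 2 := by gcongr
        _ = (1 + ρ) / (1 - ρ) * y ^ 2 := by field_simp; ring
        _ ≤ _ := by
          gcongr
    have t4 := bernstein_step (x := ‖α‖ * c) (y := y) (Multiset.card s) hr hr1
    have t5 : ‖α‖ ^ 2 * (1 - ρ ^ 2)⁻¹ = (‖α‖ * c) ^ 2 := by rw [mul_pow, hk2]
    rw [hN, t5, Multiset.card_cons]
    linarith

end SmoothSeries

open SmoothSeries

/-! ### The norms of the three spaces -/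

theorem hardyNorm_eq {f : ℂ → ℂ} {a : CoeffSpace} (ha : ∀ k, a k = taylorCoeff f k) :
    hardyNorm f = ENNReal.ofReal ‖a‖ := by
  have h2 : (0 : ℝ) < (2 : ℝ≥0∞).toReal := by norm_num
  have h := lp.hasSum_norm h2 a
  simp only [ENNReal.toReal_ofNat, Real.rpow_ofNat] at h
  have h1 : ∑' k, ‖taylorCoeff f k‖ₑ ^ 2 = ENNReal.ofReal (‖a‖ ^ 2) := by
    rw [← h.tsum_eq, ENNReal.ofReal_tsum_of_nonneg (fun k => by positivity) h.summable]
    refine tsum_congr fun k => ?_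
    rw [← ha, ENNReal.ofReal_pow (norm_nonneg _), ofReal_norm]
  rw [hardyNorm, h1, ENNReal.ofReal_pow (norm_nonneg _), ← ENNReal.rpow_natCast,
    ← ENNReal.rpow_mul]
  norm_num

theorem exists_coeffSpace {f : ℂ → ℂ} (hf : hardyNorm f ≠ ∞) :
    ∃ a : CoeffSpace, ∀ k, a k = taylorCoeff f k := by
  suffices hm : Memℓp (taylorCoeff f) 2 from ⟨⟨taylorCoeff f, hm⟩, fun k => rfl⟩
  rw [memℓp_gen_iff (by norm_num)]
  have h : ∑' k, ‖taylorCoeff f k‖ₑ ^ 2 ≠ ∞ := by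
    intro h
    rw [hardyNorm, h] at hf
    simp at hf
  refine (ENNReal.summable_toReal h).congr fun k => ?_
  simp

/-- The Dirichlet energy `∑ k |f̂(k)|²`, which is the square of the Bergman norm of `f'`. -/
def energy (f : ℂ → ℂ) : ℝ≥0∞ := ∑' k : ℕ, (k : ℝ≥0∞) * ‖taylorCoeff f k‖ₑ ^ 2

theorem bergmanNorm_deriv (f : ℂ → ℂ) : bergmanNorm (deriv f) = energy f ^ (1 / 2 : ℝ) := by
  rw [bergmanNorm, energy,
    tsum_eq_zero_add' (f := fun k : ℕ => (k : ℝ≥0∞) * ‖taylorCoeff f k‖ₑ ^ 2) ENNReal.summable]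
  congr 1
  rw [Nat.cast_zero, zero_mul, zero_add]
  refine tsum_congr fun k => ?_
  have h : taylorCoeff (deriv f) k = ((k : ℂ) + 1) * taylorCoeff f (k + 1) := by
    simpa using taylorCoeff_iteratedDeriv f 1 k
  have h2 : ‖(k : ℂ) + 1‖ₑ = (k : ℝ≥0∞) + 1 := by
    rw [← ofReal_norm, ← Nat.cast_succ, Complex.norm_natCast, ENNReal.ofReal_natCast]
    push_cast
    rfl
  have h3 : (k : ℝ≥0∞) + 1 ≠ 0 := by simp
  have h4 : (k : ℝ≥0∞) + 1 ≠ ∞ := by simp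
  rw [h, enorm_mul, h2, mul_pow, sq ((k : ℝ≥0∞) + 1), mul_assoc, mul_comm,
    ENNReal.mul_div_cancel_right h3 h4]
  push_cast
  rfl

theorem dirichletNorm_eq (f : ℂ → ℂ) :
    dirichletNorm f = (hardyNorm f ^ 2 + energy f) ^ (1 / 2 : ℝ) := by
  have h : hardyNorm f ^ 2 = ∑' k, ‖taylorCoeff f k‖ₑ ^ 2 := by
    rw [hardyNorm, ← ENNReal.rpow_natCast, ← ENNReal.rpow_mul]
    norm_num
  rw [dirichletNorm, h, energy, ← ENNReal.tsum_add]
  congr 1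
  refine tsum_congr fun k => ?_
  ring

theorem hasSum_energy (φ : SmoothSeries) :
    HasSum (fun k : ℕ => (k : ℝ) * ‖φ.cf k‖ ^ 2)
      (inner ℂ (toCoeff (euler φ)) (toCoeff φ)).re := by
  have h := Complex.hasSum_re (lp.hasSum_inner (𝕜 := ℂ) (toCoeff (euler φ)) (toCoeff φ))
  refine h.congr_fun fun k => ?_
  have : φ.cf k * conj ((k : ℂ) * φ.cf k) = (((k : ℝ) * ‖φ.cf k‖ ^ 2 : ℝ) : ℂ) := by
    rw [map_mul, Complex.conj_natCast, mul_left_comm, Complex.mul_conj']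
    push_cast
    rfl
  rw [RCLike.inner_apply, toCoeff_apply, toCoeff_apply, cf_euler, this, Complex.ofReal_re]

theorem energy_eq {f : ℂ → ℂ} {φ : SmoothSeries} (h : ∀ k, taylorCoeff f k = φ.cf k) :
    energy f = ENNReal.ofReal (inner ℂ (toCoeff (euler φ)) (toCoeff φ)).re := by
  have h1 := hasSum_energy φ
  rw [← h1.tsum_eq, ENNReal.ofReal_tsum_of_nonneg (fun k => by positivity) h1.summable, energy]
  refine tsum_congr fun k => ?_
  rw [h, ENNReal.ofReal_mul (by positivity), ENNReal.ofReal_pow (norm_nonneg _), ofReal_norm,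
    ENNReal.ofReal_natCast]

/-! ### Rational functions -/

theorem X_sub_C_eq_mul_factor {a : ℂ} (ha : a ≠ 0) : (Polynomial.X - Polynomial.C a)
    = Polynomial.C (-a) * (1 - Polynomial.C (conj (conj a⁻¹)) * Polynomial.X) := by
  rw [RCLike.conj_conj, mul_sub, ← mul_assoc, ← Polynomial.C_mul, neg_mul, mul_inv_cancel₀ ha]
  simp only [map_neg, map_one]
  ring

/-- A rational function in `ratFunctions n r` is a quotient `p / den s` with exactly `n` points
in `s`: the reflections `1 / \bar ζ` of the poles, completed by zeros if `deg q < n`. -/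
theorem exists_smoothSeries_of_mem {n : ℕ} {r : ℝ} (hr1 : r < 1) (hr : 0 ≤ r)
    {f : ℂ → ℂ} (hf : f ∈ ratFunctions n r) :
    ∃ (s : Multiset ℂ) (φ : SmoothSeries) (p : Polynomial ℂ), Multiset.card s = n ∧
      (∀ l ∈ s, ‖l‖ ≤ r) ∧ p.degree < (Multiset.card s : WithBot ℕ) ∧
      φ * ofPoly (den s) = ofPoly p ∧ ∀ k, taylorCoeff f k = φ.cf k := by
  obtain ⟨p, q, hp, hq, hz, rfl⟩ := hf
  have hq0 : q ≠ 0 := by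
    rintro rfl
    have := hz 0 (by simp)
    norm_num at this
  have hroot : ∀ a ∈ q.roots, 1 ≤ r * ‖a‖ := fun a ha =>
    hz a ((Polynomial.mem_roots hq0).mp ha)
  have ha0 : ∀ a ∈ q.roots, a ≠ 0 := by
    rintro a ha rfl
    have := hroot 0 ha
    norm_num at this
  have hcard : Multiset.card q.roots ≤ n := by
    refine (Polynomial.card_roots' q).trans ?_
    rw [Polynomial.natDegree_le_iff_degree_le]
    exact hq
  set s : Multiset ℂ := q.roots.map (fun a => conj a⁻¹)
    + Multiset.replicate (n - Multiset.card q.roots) 0 with hs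
  have hsc : Multiset.card s = n := by
    rw [hs, Multiset.card_add, Multiset.card_map, Multiset.card_replicate]
    omega
  have hsr : ∀ l ∈ s, ‖l‖ ≤ r := by
    intro l hl
    rw [hs, Multiset.mem_add, Multiset.mem_map] at hl
    rcases hl with ⟨a, ha, rfl⟩ | hl
    · have h0 : 0 < ‖a‖ := norm_pos_iff.mpr (ha0 a ha)
      rw [RCLike.norm_conj, norm_inv, inv_le_iff_one_le_mul₀ h0]
      exact hroot a ha
    · rw [Multiset.eq_of_mem_replicate hl, norm_zero]
      exact hr
  obtain ⟨c, hc, hqc⟩ : ∃ c : ℂ, c ≠ 0 ∧ q = Polynomial.C c * den s := by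
    refine ⟨q.leadingCoeff * (q.roots.map fun a => -a).prod, ?_, ?_⟩
    · refine mul_ne_zero (Polynomial.leadingCoeff_ne_zero.mpr hq0) ?_
      rw [Ne, Multiset.prod_eq_zero_iff, Multiset.mem_map]
      rintro ⟨a, ha, h⟩
      exact ha0 a ha (neg_eq_zero.mp h)
    · conv_lhs => rw [(IsAlgClosed.splits q).eq_prod_roots]
      have h1 : den s = (q.roots.map fun a =>
          1 - Polynomial.C (conj (conj a⁻¹)) * Polynomial.X).prod := by
        rw [hs, den, Multiset.map_add, Multiset.prod_add, Multiset.map_map]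
        simp
      have h2 : (q.roots.map fun a => Polynomial.X - Polynomial.C a)
          = q.roots.map fun a => Polynomial.C (-a)
            * (1 - Polynomial.C (conj (conj a⁻¹)) * Polynomial.X) :=
        Multiset.map_congr rfl fun a ha => X_sub_C_eq_mul_factor (ha0 a ha)
      rw [h2, Multiset.prod_map_mul, h1, Polynomial.C_mul, mul_assoc]
      congr 2
      rw [map_multiset_prod, Multiset.map_map]
      rfl
  obtain ⟨κ, hκ⟩ := exists_mul_den_eq_one fun l hl => (hsr l hl).trans_lt hr1
  refine ⟨s, κ * ofPoly (Polynomial.C c⁻¹ * p), Polynomial.C c⁻¹ * p, hsc, hsr, ?_, ?_, ?_⟩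
  · rw [hsc, Polynomial.degree_C_mul (inv_ne_zero hc)]
    exact hp
  · rw [mul_right_comm, hκ, one_mul]
  · refine taylorCoeff_div ?_ fun z hz' h0 => ?_
    · rw [hqc, ofPoly_C_mul, ofPoly_C_mul, mul_smul_comm, mul_smul_comm, smul_mul_assoc,
        smul_smul, mul_inv_cancel₀ hc, one_smul, mul_right_comm, hκ, one_mul]
    · have h1 := hz z h0
      have h2 : ‖z‖ < 1 := by simpa [disc] using hz'
      nlinarith [norm_nonneg z]

theorem energy_le_of_mem {n : ℕ} {r : ℝ} (hr : 0 ≤ r) (hr1 : r < 1)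
    {f : ℂ → ℂ} (hf : f ∈ ratFunctions n r) :
    energy f ≤ ENNReal.ofReal ((n * (1 + r) + √(n : ℝ)) / (1 - r)) * hardyNorm f ^ 2 := by
  obtain ⟨s, φ, p, hs, hsr, hp, h, ht⟩ := exists_smoothSeries_of_mem hr1 hr hf
  have h1 := re_inner_euler_le hr hr1 s hsr φ p hp h
  have h3 : 0 ≤ (n * (1 + r) + √(n : ℝ)) / (1 - r) :=
    div_nonneg (by positivity) (by linarith)
  rw [energy_eq ht, hardyNorm_eq (a := toCoeff φ) fun k => (ht k).symm,
    ← ENNReal.ofReal_pow (norm_nonneg _), ← ENNReal.ofReal_mul h3]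
  rw [hs] at h1
  exact ENNReal.ofReal_le_ofReal h1

theorem hardyNorm_ne_top_of_mem {n : ℕ} {r : ℝ} (hr : 0 ≤ r) (hr1 : r < 1)
    {f : ℂ → ℂ} (hf : f ∈ ratFunctions n r) : hardyNorm f ≠ ∞ := by
  obtain ⟨s, φ, p, hs, hsr, hp, h, ht⟩ := exists_smoothSeries_of_mem hr1 hr hf
  rw [hardyNorm_eq (a := toCoeff φ) fun k => (ht k).symm]
  exact ENNReal.ofReal_ne_top

theorem sq_rpow_half (x : ℝ≥0∞) : (x ^ 2) ^ (1 / 2 : ℝ) = x := by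
  rw [← ENNReal.rpow_natCast, ← ENNReal.rpow_mul]
  norm_num

theorem rpow_half_sq (x : ℝ≥0∞) : (x ^ (1 / 2 : ℝ)) ^ 2 = x := by
  rw [← ENNReal.rpow_natCast, ← ENNReal.rpow_mul]
  norm_num

theorem bernstein_mem {n : ℕ} {r : ℝ} (hr : 0 ≤ r) (hr1 : r < 1) :
    ENNReal.ofReal ((n * (1 + r) + √(n : ℝ)) / (1 - r)) ^ (1 / 2 : ℝ) ∈
      {C : ℝ≥0∞ | ∀ f ∈ ratFunctions n r, bergmanNorm (deriv f) ≤ C * hardyNorm f} := by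
  intro f hf
  rw [bergmanNorm_deriv]
  refine (ENNReal.rpow_le_rpow (energy_le_of_mem hr hr1 hf) (by norm_num)).trans ?_
  rw [ENNReal.mul_rpow_of_nonneg _ _ (by norm_num : (0 : ℝ) ≤ 1 / 2), sq_rpow_half]

theorem bernsteinConst_sq_le {n : ℕ} {r : ℝ} (hr : 0 ≤ r) (hr1 : r < 1) :
    bernsteinConst bergmanNorm hardyNorm n r ^ 2
      ≤ ENNReal.ofReal ((n * (1 + r) + √(n : ℝ)) / (1 - r)) := by
  rw [← rpow_half_sq (ENNReal.ofReal _)]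
  gcongr
  exact sInf_le (bernstein_mem hr hr1)

/-- The infimum defining the Bernstein constant is attained. -/
theorem bergmanNorm_deriv_le {n : ℕ} {r : ℝ} (hr : 0 ≤ r) (hr1 : r < 1)
    {f : ℂ → ℂ} (hf : f ∈ ratFunctions n r) :
    bergmanNorm (deriv f) ≤ bernsteinConst bergmanNorm hardyNorm n r * hardyNorm f := by
  rcases eq_or_ne (hardyNorm f) 0 with h0 | h0
  · have := bernstein_mem hr hr1 f hf
    rw [h0, mul_zero] at this ⊢
    exact this
  · rw [← ENNReal.div_le_iff h0 (hardyNorm_ne_top_of_mem hr hr1 hf)]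
    refine le_sInf fun C hC => ?_
    rw [ENNReal.div_le_iff h0 (hardyNorm_ne_top_of_mem hr hr1 hf)]
    exact hC f hf

/-! ### Interpolation by the orthogonal projection -/

/-- The kernels representing the divided derivatives of order less than `count μ s` at `μ` are
quotients by `den s`. -/
theorem exists_kernel_mul_den {s : Multiset ℂ} {μ : ℂ} (hμ : ‖μ‖ < 1) {i : ℕ}
    (hi : i < s.count μ) :
    ∃ p : Polynomial ℂ, p.degree < (Multiset.card s : WithBot ℕ) ∧
      var ^ i * szego μ hμ ^ (i + 1) * ofPoly (den s) = ofPoly p := by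
  obtain ⟨t, ht⟩ := Multiset.le_iff_exists_add.mp
    (Multiset.le_count_iff_replicate_le.mp (Nat.succ_le_of_lt hi))
  have hden : den s = (1 - Polynomial.C (conj μ) * Polynomial.X) ^ (i + 1) * den t := by
    rw [ht, den, Multiset.map_add, Multiset.prod_add, Multiset.map_replicate,
      Multiset.prod_replicate, den]
  refine ⟨Polynomial.X ^ i * den t, ?_, ?_⟩
  · rw [Polynomial.degree_mul, Polynomial.degree_X_pow, ht, Multiset.card_add,
      Multiset.card_replicate]
    push_cast
    refine (add_le_add_right (degree_den_le t) _).trans_lt ?_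
    norm_cast
    omega
  · rw [hden, map_mul, map_pow, ofPoly_factor, map_mul, map_pow]
    have h : szego μ hμ ^ (i + 1) * (1 - conj μ • var) ^ (i + 1) = 1 := by
      rw [← mul_pow, szego_mul, one_pow]
    change _ = var ^ i * _
    linear_combination (var ^ i * ofPoly (den t)) * h

/-- The orthogonal projection of `f` onto the space of the functions `p / den s` has the same
trace on `s` as `f`. -/
theorem exists_interpolant {s : Multiset ℂ} (hs : ∀ μ ∈ s, ‖μ‖ < 1) {f : ℂ → ℂ} (hf : Hol f)
    {a : CoeffSpace} (ha : ∀ k, a k = taylorCoeff f k) :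
    ∃ (φ : SmoothSeries) (p : Polynomial ℂ), p.degree < (Multiset.card s : WithBot ℕ) ∧
      φ * ofPoly (den s) = ofPoly p ∧ ‖toCoeff φ‖ ≤ ‖a‖ ∧
      SameTrace s f (fun z => p.eval z / (den s).eval z) := by
  obtain ⟨κ, hκ⟩ := exists_mul_den_eq_one hs
  have hev : ∀ z ∈ disc, (den s).eval z ≠ 0 := fun z hz => by
    refine eval_den_ne_zero fun μ hμ => ?_
    have h1 : ‖z‖ < 1 := by simpa [disc] using hz
    nlinarith [hs μ hμ, norm_nonneg z, norm_nonneg μ]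
  let T : Polynomial ℂ →ₗ[ℂ] CoeffSpace :=
    toCoeff ∘ₗ LinearMap.mulLeft ℂ κ ∘ₗ ofPoly.toLinearMap
  let V : Submodule ℂ CoeffSpace := (Polynomial.degreeLT ℂ (Multiset.card s)).map T
  have hfin : FiniteDimensional ℂ (Polynomial.degreeLT ℂ (Multiset.card s)) :=
    (Polynomial.degreeLTEquiv ℂ (Multiset.card s)).symm.finiteDimensional
  have : FiniteDimensional ℂ V := inferInstance
  obtain ⟨p, hp, hpT⟩ := V.starProjection_apply_mem a
  rw [SetLike.mem_coe, Polynomial.mem_degreeLT] at hp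
  change toCoeff (κ * ofPoly p) = _ at hpT
  have hφ : κ * ofPoly p * ofPoly (den s) = ofPoly p := by rw [mul_right_comm, hκ, one_mul]
  refine ⟨κ * ofPoly p, p, hp, hφ, ?_, ?_⟩
  · rw [hpT]
    exact V.norm_starProjection_apply_le a
  · intro μ hμ i hi
    obtain ⟨P, hP, hPK⟩ := exists_kernel_mul_den (hs μ hμ) hi
    have hmem : toCoeff (var ^ i * szego μ (hs μ hμ) ^ (i + 1)) ∈ V := by
      refine ⟨P, Polynomial.mem_degreeLT.mpr hP, ?_⟩
      change toCoeff (κ * ofPoly P) = _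
      rw [← hPK, mul_left_comm, hκ, mul_one]
    have horth := (V.mem_orthogonal _).mp (V.sub_starProjection_mem_orthogonal a) _ hmem
    rw [← hpT, inner_sub_right, inner_szego_pow hf a ha,
      inner_szego_pow (hol_div (p := p) hev) _ fun k => (taylorCoeff_div hφ hev k).symm,
      sub_eq_zero] at horth
    have hfac : (i.factorial : ℂ) ≠ 0 := by exact_mod_cast i.factorial_ne_zero
    exact ((div_left_inj' hfac).mp horth).symm

theorem den_mem_ratFunctions {n : ℕ} {r : ℝ} {s : Multiset ℂ} (hn : Multiset.card s ≤ n)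
    (hs : ∀ μ ∈ s, ‖μ‖ ≤ r) {p : Polynomial ℂ} (hp : p.degree < (Multiset.card s : WithBot ℕ)) :
    (fun z => p.eval z / (den s).eval z) ∈ ratFunctions n r := by
  have hn' : (Multiset.card s : WithBot ℕ) ≤ n := by exact_mod_cast hn
  refine ⟨p, den s, hp.trans_le hn', (degree_den_le s).trans hn', fun ζ hζ => ?_, rfl⟩
  by_contra! h
  refine eval_den_ne_zero (fun μ hμ => ?_) hζ
  exact (mul_le_mul_of_nonneg_right (hs μ hμ) (norm_nonneg ζ)).trans_lt h

theorem worstInterpConst_le {n : ℕ} {r : ℝ} (hr : 0 ≤ r) (hr1 : r < 1) :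
    worstInterpConst hardyNorm dirichletNorm n r
      ≤ (bernsteinConst bergmanNorm hardyNorm n r ^ 2 + 1) ^ (1 / 2 : ℝ) := by
  refine iSup₂_le fun s hs => iSup₂_le fun f hf => ?_
  obtain ⟨hcard, hs⟩ := hs
  obtain ⟨hol, hf1⟩ := hf
  obtain ⟨a, ha⟩ := exists_coeffSpace (hf1.trans_lt ENNReal.one_lt_top).ne
  have hs1 : ∀ μ ∈ s, ‖μ‖ < 1 := fun μ hμ => (hs μ hμ).2.trans_lt hr1
  obtain ⟨φ, p, hp, hφ, hle, htr⟩ := exists_interpolant hs1 hol ha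
  have hev : ∀ z ∈ disc, (den s).eval z ≠ 0 := fun z hz => by
    refine eval_den_ne_zero fun μ hμ => ?_
    have h1 : ‖z‖ < 1 := by simpa [disc] using hz
    nlinarith [hs1 μ hμ, norm_nonneg z, norm_nonneg μ]
  set g : ℂ → ℂ := fun z => p.eval z / (den s).eval z with hg
  have hgt : ∀ k, taylorCoeff g k = φ.cf k := taylorCoeff_div hφ hev
  have hmem : g ∈ ratFunctions n r := den_mem_ratFunctions hcard (fun μ hμ => (hs μ hμ).2) hp
  have hg1 : hardyNorm g ≤ 1 := by
    refine le_trans ?_ hf1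
    rw [hardyNorm_eq (a := toCoeff φ) fun k => (hgt k).symm, hardyNorm_eq ha]
    exact ENNReal.ofReal_le_ofReal hle
  have hB := bergmanNorm_deriv_le hr hr1 hmem
  have hE : energy g ≤ bernsteinConst bergmanNorm hardyNorm n r ^ 2 := by
    rw [← rpow_half_sq (energy g), ← bergmanNorm_deriv]
    gcongr
    exact hB.trans (mul_le_of_le_one_right' hg1)
  have hD : dirichletNorm g ≤ (bernsteinConst bergmanNorm hardyNorm n r ^ 2 + 1) ^ (1 / 2 : ℝ) := by
    rw [dirichletNorm_eq, add_comm]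
    gcongr
    exact pow_le_one₀ zero_le hg1
  refine (iInf₂_le g ⟨hol_div hev, ?_, htr⟩).trans hD
  rw [dirichletNorm_eq, energy_eq hgt]
  refine ENNReal.rpow_lt_top_of_nonneg (by norm_num) (ENNReal.add_ne_top.mpr ⟨?_, ?_⟩)
  · exact ENNReal.pow_ne_top (hg1.trans_lt ENNReal.one_lt_top).ne
  · exact ENNReal.ofReal_ne_top

namespace SmoothSeries
variable {l ω : ℂ} {hl : ‖l‖ < 1}

/-! ### Powers of a Blaschke factor -/

/-- The Blaschke factor `ω (z - l) / (1 - \bar l z)`. -/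
def blaschke (ω l : ℂ) (hl : ‖l‖ < 1) : SmoothSeries :=
  ω • (var * szego l hl - l • szego l hl)

theorem sub_smul_var_mul_szego (φ : SmoothSeries) :
    φ * szego l hl - conj l • (var * (φ * szego l hl)) = φ := by
  have hk := szego_mul (l := l) (hl := hl)
  simp only [Algebra.smul_def] at hk ⊢
  linear_combination φ * hk

theorem mul_blaschke (φ : SmoothSeries) : φ * blaschke ω l hl
    = ω • (var * (φ * szego l hl) - l • (φ * szego l hl)) := by
  simp only [blaschke, Algebra.smul_def]
  ring

theorem inner_mul_blaschke (hω : ‖ω‖ = 1) (φ ψ : SmoothSeries) :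
    inner ℂ (toCoeff (φ * blaschke ω l hl)) (toCoeff (ψ * blaschke ω l hl))
      = inner ℂ (toCoeff φ) (toCoeff ψ) := by
  have h : conj ω * ω = 1 := by rw [conj_mul_self_eq, hω]; simp
  rw [mul_blaschke, mul_blaschke, map_smul, map_smul, inner_smul_left, inner_smul_right,
    inner_blaschke, sub_smul_var_mul_szego, sub_smul_var_mul_szego, ← mul_assoc, h, one_mul]

theorem inner_euler_mul_blaschke (hω : ‖ω‖ = 1) (φ ψ : SmoothSeries) :
    inner ℂ (toCoeff (euler (φ * blaschke ω l hl))) (toCoeff (ψ * blaschke ω l hl))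
      = inner ℂ (toCoeff (euler φ)) (toCoeff ψ) + (1 - (‖l‖ : ℂ) ^ 2)
        * inner ℂ (toCoeff (φ * szego l hl)) (toCoeff (ψ * szego l hl)) := by
  have h : conj ω * ω = 1 := by rw [conj_mul_self_eq, hω]; simp
  rw [mul_blaschke, mul_blaschke, map_smul euler, map_smul, map_smul, inner_smul_left,
    inner_smul_right, inner_euler_blaschke, sub_smul_var_mul_szego, sub_smul_var_mul_szego,
    ← mul_assoc, h, one_mul]

theorem inner_szego_mul_blaschke (φ : SmoothSeries) :
    inner ℂ (toCoeff (szego l hl)) (toCoeff (φ * blaschke ω l hl)) = 0 := by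
  rw [mul_blaschke, map_smul, inner_smul_right, inner_szego_blaschke, mul_zero]

/-- The functions `B ^ i / (1 - \bar l z)` are orthogonal in `H²`, with equal norms. -/
theorem inner_blaschke_pow_mul_szego (hω : ‖ω‖ = 1) (i j : ℕ) :
    inner ℂ (toCoeff (blaschke ω l hl ^ i * szego l hl))
        (toCoeff (blaschke ω l hl ^ j * szego l hl))
      = if i = j then (((1 - ‖l‖ ^ 2)⁻¹ : ℝ) : ℂ) else 0 := by
  have hz : ∀ m : ℕ, inner ℂ (toCoeff (szego l hl))
      (toCoeff (blaschke ω l hl ^ (m + 1) * szego l hl)) = 0 := fun m => by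
    rw [pow_succ, mul_right_comm, inner_szego_mul_blaschke]
  induction i generalizing j with
  | zero =>
    cases j with
    | zero => simp only [pow_zero, one_mul, if_true, inner_szego_self]
    | succ j => simp only [pow_zero, one_mul, hz, (Nat.succ_ne_zero j).symm, if_false]
  | succ i ih =>
    cases j with
    | zero =>
      rw [← inner_conj_symm, pow_zero, one_mul, hz, map_zero, if_neg (Nat.succ_ne_zero i)]
    | succ j =>
      rw [pow_succ, pow_succ, mul_right_comm, mul_right_comm _ _ (szego l hl),
        inner_mul_blaschke hω, ih]
      simp

/-- The powers of a Blaschke factor are orthogonal in the Dirichlet form, and the `i`-th one has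
energy `i`. -/
theorem inner_euler_blaschke_pow (hω : ‖ω‖ = 1) (i j : ℕ) :
    inner ℂ (toCoeff (euler (blaschke ω l hl ^ i))) (toCoeff (blaschke ω l hl ^ j))
      = if i = j then (i : ℂ) else 0 := by
  induction i generalizing j with
  | zero => simp
  | succ i ih =>
    cases j with
    | zero => rw [inner_euler_left]; simp
    | succ j =>
      rw [pow_succ, pow_succ, inner_euler_mul_blaschke hω, ih, inner_blaschke_pow_mul_szego hω]
      have hp : ((1 - ‖l‖ ^ 2 : ℝ) : ℂ) ≠ 0 := by exact_mod_cast (one_sub_normSq_pos hl).ne'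
      by_cases h : i = j
      · simp only [h, if_true]
        push_cast at hp ⊢
        rw [mul_inv_cancel₀ hp]
      · simp [h]

theorem blaschke_eq : blaschke ω l hl
    = (ω * (1 - (‖l‖ : ℂ) ^ 2)) • (var * szego l hl) - (ω * l) • 1 := by
  have hk := szego_mul (l := l) (hl := hl)
  rw [← conj_mul_self_eq]
  simp only [blaschke, Algebra.smul_def, map_mul, map_sub, map_one] at hk ⊢
  linear_combination -(algebraMap ℂ SmoothSeries ω * algebraMap ℂ SmoothSeries l) * hk

theorem euler_blaschke : euler (blaschke ω l hl)
    = (ω * (1 - (‖l‖ : ℂ) ^ 2)) • (var * szego l hl ^ 2) := by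
  have hk := szego_mul (l := l) (hl := hl)
  rw [blaschke_eq, map_sub, map_smul, map_smul, euler_one, euler_var_mul, euler_szego]
  simp only [Algebra.smul_def, map_mul, map_sub, map_one, map_pow] at hk ⊢
  linear_combination -(algebraMap ℂ SmoothSeries ω
    * (1 - algebraMap ℂ SmoothSeries (‖l‖ : ℂ) ^ 2)) * (var * szego l hl) * hk

theorem inner_kernel_mul_blaschke_pow {n : ℕ} {c : CoeffSpace}
    (hc : ∀ i < n, inner ℂ (toCoeff (var ^ i * szego l hl ^ (i + 1))) c = 0) (j i : ℕ)
    (hij : i + j < n) :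
    inner ℂ (toCoeff (var ^ i * szego l hl ^ (i + 1) * blaschke ω l hl ^ j)) c = 0 := by
  induction j generalizing i with
  | zero => simpa using hc i (by omega)
  | succ j ih =>
    have h : var ^ i * szego l hl ^ (i + 1) * blaschke ω l hl ^ (j + 1)
        = (ω * (1 - (‖l‖ : ℂ) ^ 2))
            • (var ^ (i + 1) * szego l hl ^ (i + 1 + 1) * blaschke ω l hl ^ j)
          - (ω * l) • (var ^ i * szego l hl ^ (i + 1) * blaschke ω l hl ^ j) := by
      rw [pow_succ (blaschke ω l hl)]
      nth_rewrite 2 [blaschke_eq]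
      simp only [Algebra.smul_def]
      ring
    rw [h, map_sub, map_smul, map_smul, inner_sub_left, inner_smul_left, inner_smul_left,
      ih (i + 1) (by omega), ih i (by omega)]
    simp

/-- The Dirichlet pairing with `B ^ j`, `j < n`, only depends on the trace at `n` times the point
`l`. -/
theorem inner_euler_blaschke_pow_eq_zero {n : ℕ} {c : CoeffSpace}
    (hc : ∀ i < n, inner ℂ (toCoeff (var ^ i * szego l hl ^ (i + 1))) c = 0) {j : ℕ}
    (hj : j < n) : inner ℂ (toCoeff (euler (blaschke ω l hl ^ j))) c = 0 := by
  cases j with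
  | zero => simp
  | succ j =>
    have h := inner_kernel_mul_blaschke_pow (ω := ω) hc j 1 (by omega)
    rw [pow_one] at h
    rw [euler_pow, euler_blaschke, map_smul, mul_smul_comm, map_smul, mul_comm (_ ^ j),
      inner_smul_left, inner_smul_left, h, mul_zero, mul_zero]

/-! ### The extremal function -/

/-- The sum of the first `n` powers of the Blaschke factor. -/
def blaschkeSum (ω l : ℂ) (hl : ‖l‖ < 1) (n : ℕ) : SmoothSeries :=
  ∑ i ∈ Finset.range n, blaschke ω l hl ^ i

theorem sum_range_cast_eq (n : ℕ) : ∑ i ∈ Finset.range n, (i : ℂ) = n * (n - 1) / 2 := by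
  induction n with
  | zero => simp
  | succ n ih =>
    rw [Finset.sum_range_succ, ih]
    push_cast
    ring

theorem inner_euler_blaschkeSum (hω : ‖ω‖ = 1) (n : ℕ) :
    inner ℂ (toCoeff (euler (blaschkeSum ω l hl n))) (toCoeff (blaschkeSum ω l hl n))
      = n * (n - 1) / 2 := by
  rw [← sum_range_cast_eq, blaschkeSum]
  simp only [map_sum, sum_inner, inner_sum, inner_euler_blaschke_pow hω]
  refine Finset.sum_congr rfl fun i hi => ?_
  rw [Finset.sum_ite_eq', if_pos hi]

theorem normSq_blaschkeSum_mul_szego (hω : ‖ω‖ = 1) (n : ℕ) :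
    ‖toCoeff (blaschkeSum ω l hl n * szego l hl)‖ ^ 2 = n * (1 - ‖l‖ ^ 2)⁻¹ := by
  have h : inner ℂ (toCoeff (blaschkeSum ω l hl n * szego l hl))
      (toCoeff (blaschkeSum ω l hl n * szego l hl)) = n * (((1 - ‖l‖ ^ 2)⁻¹ : ℝ) : ℂ) := by
    rw [blaschkeSum, Finset.sum_mul]
    simp only [map_sum, sum_inner, inner_sum, inner_blaschke_pow_mul_szego hω]
    rw [Finset.sum_congr rfl fun i hi => by rw [Finset.sum_ite_eq', if_pos hi], Finset.sum_const,
      Finset.card_range, nsmul_eq_mul]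
  rw [← Complex.ofReal_inj]
  push_cast at h ⊢
  rw [← h, inner_self_eq_norm_sq_to_K]
  simp

theorem blaschkeSum_mul_szego (hωl : conj l = ‖l‖ * ω) (n : ℕ) :
    blaschkeSum ω l hl n * szego l hl
      = (1 - (‖l‖ : ℂ))⁻¹ • blaschkeSum ω l hl n
        + ((‖l‖ : ℂ) * (1 - (‖l‖ : ℂ) ^ 2)⁻¹) • (blaschke ω l hl ^ n - 1) := by
  have hp : (1 - (‖l‖ : ℂ) ^ 2) ≠ 0 := by exact_mod_cast (one_sub_normSq_pos hl).ne'
  have hp1 : (1 - (‖l‖ : ℂ)) ≠ 0 := by exact_mod_cast (sub_pos.mpr hl).ne'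
  have h1 : (1 - (‖l‖ : ℂ) ^ 2) • szego l hl = 1 + (‖l‖ : ℂ) • blaschke ω l hl := by
    have hk := szego_mul (l := l) (hl := hl)
    rw [blaschke, smul_smul, ← hωl, ← conj_mul_self_eq]
    simp only [Algebra.smul_def, map_mul, map_sub, map_one] at hk ⊢
    linear_combination hk
  have h2 : blaschkeSum ω l hl n * blaschke ω l hl
      = blaschkeSum ω l hl n + (blaschke ω l hl ^ n - 1) := by
    have := geom_sum_mul (blaschke ω l hl) n
    rw [mul_sub, mul_one] at this
    exact (eq_add_of_sub_eq' this)
  have h3 : szego l hl = (1 - (‖l‖ : ℂ) ^ 2)⁻¹ • (1 + (‖l‖ : ℂ) • blaschke ω l hl) := by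
    rw [← h1, smul_smul, inv_mul_cancel₀ hp, one_smul]
  have h4 : (1 - (‖l‖ : ℂ))⁻¹ = (1 - (‖l‖ : ℂ) ^ 2)⁻¹ * (1 + ‖l‖) := by
    field_simp
    ring
  rw [h3, mul_smul_comm, mul_add, mul_one, mul_smul_comm, h2, h4]
  simp only [Algebra.smul_def, map_mul, map_add, map_one]
  ring

theorem inner_euler_blaschkeSum_mul_szego (hω : ‖ω‖ = 1) (hωl : conj l = ‖l‖ * ω) (n : ℕ) :
    inner ℂ (toCoeff (euler (blaschkeSum ω l hl n)))
        (toCoeff (blaschkeSum ω l hl n * szego l hl))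
      = (1 - (‖l‖ : ℂ))⁻¹ * (n * (n - 1) / 2) := by
  have h1 : inner ℂ (toCoeff (euler (blaschkeSum ω l hl n))) (toCoeff (blaschke ω l hl ^ n))
      = 0 := by
    rw [blaschkeSum]
    simp only [map_sum, sum_inner, inner_euler_blaschke_pow hω]
    exact Finset.sum_eq_zero fun i hi => if_neg (Finset.mem_range.mp hi).ne
  have h2 : inner ℂ (toCoeff (euler (blaschkeSum ω l hl n))) (toCoeff 1) = 0 := by
    rw [inner_euler_left]
    simp
  rw [blaschkeSum_mul_szego hωl, map_add, map_smul, map_smul, map_sub, inner_add_right,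
    inner_smul_right, inner_smul_right, inner_sub_right, h1, h2, inner_euler_blaschkeSum hω]
  ring

end SmoothSeries

/-! ### The lower bound -/

/-- The inequality `‖g‖² ≥ 2 t Re ⟨g, φ⟩ - t² ‖φ‖²` for the Dirichlet form. -/
theorem le_energy {g : ℂ → ℂ} {b : CoeffSpace} (hb : ∀ k, b k = taylorCoeff g k)
    (φ : SmoothSeries) (t : ℝ) :
    ENNReal.ofReal (2 * t * (inner ℂ (toCoeff (euler φ)) b).re
      - t ^ 2 * (inner ℂ (toCoeff (euler φ)) (toCoeff φ)).re) ≤ energy g := by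
  rcases eq_or_ne (energy g) ∞ with htop | htop
  · rw [htop]
    exact le_top
  have h1 : ∀ k : ℕ, (k : ℝ≥0∞) * ‖taylorCoeff g k‖ₑ ^ 2 = ENNReal.ofReal (k * ‖b k‖ ^ 2) := by
    intro k
    rw [hb, ENNReal.ofReal_mul (by positivity), ENNReal.ofReal_pow (norm_nonneg _), ofReal_norm,
      ENNReal.ofReal_natCast]
  have hs : Summable fun k : ℕ => (k : ℝ) * ‖b k‖ ^ 2 := by
    refine (ENNReal.summable_toReal htop).congr fun k => ?_
    rw [h1, ENNReal.toReal_ofReal (by positivity)]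
  rw [energy, tsum_congr h1, ← ENNReal.ofReal_tsum_of_nonneg (fun k => by positivity) hs]
  refine ENNReal.ofReal_le_ofReal ?_
  have h2 := (Complex.hasSum_re (lp.hasSum_inner (𝕜 := ℂ) (toCoeff (euler φ)) b)).mul_left (2 * t)
  refine hasSum_le (fun k => ?_) (h2.sub ((hasSum_energy φ).mul_left (t ^ 2))) hs.hasSum
  have h3 : (b k * conj ((k : ℂ) * φ.cf k)).re = k * (b k * conj (φ.cf k)).re := by
    rw [map_mul, Complex.conj_natCast, mul_left_comm, ← Complex.ofReal_natCast,
      Complex.re_ofReal_mul]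
  rw [RCLike.inner_apply, toCoeff_apply, cf_euler, h3]
  have h4 : 2 * t * (b k * conj (φ.cf k)).re - t ^ 2 * ‖φ.cf k‖ ^ 2 ≤ ‖b k‖ ^ 2 := by
    have h5 : 0 ≤ ‖b k - (t : ℂ) * φ.cf k‖ ^ 2 := sq_nonneg _
    rw [← Complex.normSq_eq_norm_sq, Complex.normSq_sub, Complex.normSq_eq_norm_sq,
      Complex.normSq_eq_norm_sq, norm_mul, Complex.norm_real, mul_pow, map_mul,
      Complex.conj_ofReal, mul_left_comm, Complex.re_ofReal_mul, Real.norm_eq_abs, sq_abs] at h5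
    linarith
  have h6 := mul_le_mul_of_nonneg_left h4 (Nat.cast_nonneg (α := ℝ) k)
  linarith

theorem exists_norm_one_conj_eq (l : ℂ) : ∃ ω : ℂ, ‖ω‖ = 1 ∧ conj l = ‖l‖ * ω := by
  rcases eq_or_ne l 0 with rfl | h
  · exact ⟨1, by simp, by simp⟩
  · have h0 : (‖l‖ : ℂ) ≠ 0 := by simpa using h
    refine ⟨conj l / ‖l‖, ?_, by field_simp⟩
    rw [norm_div, RCLike.norm_conj, Complex.norm_real, norm_norm, div_self (norm_ne_zero_iff.mpr h)]

theorem le_interpConst_replicate {n : ℕ} (hn : 1 ≤ n) {l : ℂ} (hl : ‖l‖ < 1) :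
    ENNReal.ofReal (√((n - 1) * (1 + ‖l‖) / (2 * (1 - ‖l‖))))
      ≤ interpConst hardyNorm dirichletNorm (Multiset.replicate n l) := by
  obtain ⟨ω, hω, hωl⟩ := exists_norm_one_conj_eq l
  set h := blaschkeSum ω l hl n with hh
  set N := (1 - ‖l‖ ^ 2)⁻¹ with hN
  have hpos := one_sub_normSq_pos hl
  have hp1 : 0 < 1 - ‖l‖ := by linarith
  have hn0 : (0 : ℝ) < n := by exact_mod_cast hn
  have hNn : 0 < n * N := by positivity
  -- The extremal function is `h / (1 - \bar l z)`, normalized in `H²`.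
  set c : ℝ := (√(n * N))⁻¹ with hc
  have hc2 : c ^ 2 * (n * N) = 1 := by
    rw [hc, inv_pow, Real.sq_sqrt hNn.le, inv_mul_cancel₀ hNn.ne']
  set F : SmoothSeries := (c : ℂ) • (h * szego l hl) with hF
  have hFn : ‖toCoeff F‖ = 1 := by
    rw [← pow_left_inj₀ (norm_nonneg _) zero_le_one two_ne_zero, hF, map_smul, norm_smul, mul_pow,
      normSq_blaschkeSum_mul_szego hω, Complex.norm_real, Real.norm_eq_abs, sq_abs, hc2, one_pow]
  have hF1 : hardyNorm F.toFun ≤ 1 := by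
    rw [hardyNorm_eq (a := toCoeff F) fun k => (taylorCoeff_toFun F k).symm, hFn]
    simp
  refine le_trans ?_ (le_iSup₂ (f := fun (f : ℂ → ℂ) (_ : f ∈ {f | Hol f ∧ hardyNorm f ≤ 1}) =>
    ⨅ g ∈ {g : ℂ → ℂ | Hol g ∧ dirichletNorm g < ∞ ∧ SameTrace (Multiset.replicate n l) f g},
      dirichletNorm g) F.toFun ⟨hol_toFun F, hF1⟩)
  refine le_iInf₂ fun g ⟨hg, hgD, htr⟩ => ?_
  have hgH : hardyNorm g ≠ ∞ := by
    intro htop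
    rw [dirichletNorm_eq, htop] at hgD
    simp at hgD
  obtain ⟨b, hb⟩ := exists_coeffSpace hgH
  have hker : ∀ i < n, inner ℂ (toCoeff (var ^ i * szego l hl ^ (i + 1))) (b - toCoeff F) = 0 := by
    intro i hi
    have h1 : iteratedDeriv i g l = iteratedDeriv i F.toFun l := by
      refine htr l ?_ i ?_
      · exact Multiset.mem_replicate.mpr ⟨by omega, rfl⟩
      · rwa [Multiset.count_replicate_self]
    rw [inner_sub_right, inner_szego_pow hg b hb,
      inner_szego_pow (hol_toFun F) _ fun k => (taylorCoeff_toFun F k).symm, h1, sub_self]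
  have hpair : inner ℂ (toCoeff (euler h)) b = inner ℂ (toCoeff (euler h)) (toCoeff F) := by
    rw [← sub_eq_zero, ← inner_sub_right, hh, blaschkeSum]
    simp only [map_sum, sum_inner]
    exact Finset.sum_eq_zero fun i hi =>
      inner_euler_blaschke_pow_eq_zero hker (Finset.mem_range.mp hi)
  have hpair2 : (inner ℂ (toCoeff (euler h)) b).re = c * ((1 - ‖l‖)⁻¹ * (n * (n - 1) / 2)) := by
    rw [hpair, hF, map_smul, inner_smul_right, inner_euler_blaschkeSum_mul_szego hω hωl,
      Complex.re_ofReal_mul]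
    congr 1
    rw [← Complex.ofReal_re ((1 - ‖l‖)⁻¹ * (n * (n - 1) / 2))]
    push_cast
    rfl
  have hself : (inner ℂ (toCoeff (euler h)) (toCoeff h)).re = n * (n - 1) / 2 := by
    rw [inner_euler_blaschkeSum hω, ← Complex.ofReal_re (n * (n - 1) / 2)]
    push_cast
    rfl
  -- This `t` maximizes the lower bound: `t * h` is the part of `F` seen by the energy pairing.
  have hE := le_energy hb h (c * (1 - ‖l‖)⁻¹)
  rw [hpair2, hself] at hE
  have hval : 2 * (c * (1 - ‖l‖)⁻¹) * (c * ((1 - ‖l‖)⁻¹ * (n * (n - 1) / 2)))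
      - (c * (1 - ‖l‖)⁻¹) ^ 2 * (n * (n - 1) / 2)
      = (n - 1) * (1 + ‖l‖) / (2 * (1 - ‖l‖)) := by
    have hc3 : c ^ 2 * n = 1 - ‖l‖ ^ 2 := by
      rw [hN] at hc2
      field_simp at hc2
      linarith
    have e : 2 * (c * (1 - ‖l‖)⁻¹) * (c * ((1 - ‖l‖)⁻¹ * (n * (n - 1) / 2)))
      - (c * (1 - ‖l‖)⁻¹) ^ 2 * (n * (n - 1) / 2)
        = c ^ 2 * n * (n - 1) / 2 * (1 - ‖l‖)⁻¹ ^ 2 := by ring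
    rw [e, hc3]
    field_simp
    ring
  rw [hval] at hE
  rw [dirichletNorm_eq, ← sq_rpow_half (ENNReal.ofReal _),
    ← ENNReal.ofReal_pow (Real.sqrt_nonneg _), Real.sq_sqrt (div_nonneg (mul_nonneg (by
      have : (1 : ℝ) ≤ n := by exact_mod_cast hn
      linarith) (by positivity)) (by linarith))]
  gcongr
  exact hE.trans le_add_self

/-! ### Two-sided estimates and asymptotics -/

theorem le_worstInterpConst {n : ℕ} {r : ℝ} (hn : 1 ≤ n) (hr : 0 ≤ r) (hr1 : r < 1) :
    ENNReal.ofReal (√((1 + r) / 2 * (1 - 1 / n)) * √(n / (1 - r)))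
      ≤ worstInterpConst hardyNorm dirichletNorm n r := by
  have hnr : ‖(r : ℂ)‖ = r := by rw [Complex.norm_real, Real.norm_of_nonneg hr]
  have hn0 : (0 : ℝ) < n := by exact_mod_cast hn
  have hp : 0 < 1 - r := by linarith
  have h := le_interpConst_replicate hn (l := (r : ℂ)) (by rw [hnr]; exact hr1)
  rw [hnr] at h
  refine le_trans (le_of_eq ?_) (h.trans (le_iSup₂ (f := fun (s : Multiset ℂ)
    (_ : s ∈ {σ : Multiset ℂ | Multiset.card σ ≤ n ∧ ∀ μ ∈ σ, μ ∈ disc ∧ ‖μ‖ ≤ r}) =>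
      interpConst hardyNorm dirichletNorm s) (Multiset.replicate n (r : ℂ)) ⟨?_, ?_⟩))
  · rw [← Real.sqrt_mul' _ (by positivity)]
    congr 2
    field_simp
  · rw [Multiset.card_replicate]
  · intro μ hμ
    rw [Multiset.eq_of_mem_replicate hμ, hnr]
    exact ⟨by simpa [disc, abs_of_nonneg hr] using hr1, le_rfl⟩

theorem worstInterpConst_le_ofReal {n : ℕ} {r : ℝ} (hn : 1 ≤ n) (hr : 0 ≤ r) (hr1 : r < 1) :
    worstInterpConst hardyNorm dirichletNorm n r
      ≤ ENNReal.ofReal (√(1 + r + 1 / √n + (1 - r) / n) * √(n / (1 - r))) := by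
  have hn0 : (0 : ℝ) < n := by exact_mod_cast hn
  have hp : 0 < 1 - r := by linarith
  have hv : (1 + r + 1 / √(n : ℝ) + (1 - r) / n) * (n / (1 - r))
      = (n * (1 + r) + √(n : ℝ)) / (1 - r) + 1 := by
    rw [← Real.sqrt_div_self']
    field_simp
  have h0 : 0 ≤ (n * (1 + r) + √(n : ℝ)) / (1 - r) := by positivity
  refine (worstInterpConst_le hr hr1).trans ?_
  rw [← Real.sqrt_mul' _ (by positivity), hv, ← sq_rpow_half (ENNReal.ofReal _),
    ← ENNReal.ofReal_pow (Real.sqrt_nonneg _), Real.sq_sqrt (by positivity),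
    ENNReal.ofReal_add h0 zero_le_one, ENNReal.ofReal_one]
  gcongr
  exact bernsteinConst_sq_le hr hr1

theorem tendsto_lower_factor (r : ℝ) :
    Tendsto (fun n : ℕ => √((1 + r) / 2 * (1 - 1 / n))) atTop (𝓝 (√((1 + r) / 2))) := by
  have h := (tendsto_const_nhds (x := (1 : ℝ))).sub (tendsto_const_div_atTop_nhds_zero_nat (1 : ℝ))
  simpa using (h.const_mul ((1 + r) / 2)).sqrt

theorem tendsto_upper_factor (r : ℝ) :
    Tendsto (fun n : ℕ => √(1 + r + 1 / √n + (1 - r) / n)) atTop (𝓝 (√(1 + r))) := by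
  have h1 : Tendsto (fun n : ℕ => 1 / √(n : ℝ)) atTop (𝓝 0) :=
    tendsto_const_nhds.div_atTop
      (Real.tendsto_sqrt_atTop.comp tendsto_natCast_atTop_atTop)
  have h := ((tendsto_const_nhds (x := 1 + r)).add h1).add
    (tendsto_const_div_atTop_nhds_zero_nat (1 - r))
  simpa using h.sqrt

theorem le_liminf_div_sqrt {r : ℝ} (hr : 0 ≤ r) (hr1 : r < 1) :
    ENNReal.ofReal (√(((1 + r) / 2) / (1 - r)))
      ≤ liminf (fun n : ℕ => worstInterpConst hardyNorm dirichletNorm n r /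
          ENNReal.ofReal (√n)) atTop := by
  have ht := ENNReal.tendsto_ofReal ((tendsto_lower_factor r).div_const (√(1 - r)))
  rw [Real.sqrt_div' _ (by linarith), ← ht.liminf_eq]
  refine liminf_le_liminf ?_
  filter_upwards [eventually_ge_atTop 1] with n hn
  have hn0 : 0 < √(n : ℝ) := Real.sqrt_pos.mpr (by exact_mod_cast hn)
  refine le_trans (le_of_eq ?_) (ENNReal.div_le_div_right (le_worstInterpConst hn hr hr1) _)
  rw [← ENNReal.ofReal_div_of_pos hn0, Real.sqrt_div (Nat.cast_nonneg n)]
  congr 1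
  field_simp

theorem limsup_div_sqrt_le {r : ℝ} (hr : 0 ≤ r) (hr1 : r < 1) :
    limsup (fun n : ℕ => worstInterpConst hardyNorm dirichletNorm n r /
        ENNReal.ofReal (√n)) atTop ≤ ENNReal.ofReal (√((1 + r) / (1 - r))) := by
  have ht := ENNReal.tendsto_ofReal ((tendsto_upper_factor r).div_const (√(1 - r)))
  rw [Real.sqrt_div' _ (by linarith), ← ht.limsup_eq]
  refine limsup_le_limsup ?_
  filter_upwards [eventually_ge_atTop 1] with n hn
  have hn0 : 0 < √(n : ℝ) := Real.sqrt_pos.mpr (by exact_mod_cast hn)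
  refine (ENNReal.div_le_div_right (worstInterpConst_le_ofReal hn hr hr1) _).trans (le_of_eq ?_)
  rw [← ENNReal.ofReal_div_of_pos hn0, Real.sqrt_div (Nat.cast_nonneg n)]
  congr 1
  field_simp

theorem ofReal_sqrt_mul_ofReal {n : ℕ} {r : ℝ} (hn : 1 ≤ n) (hr1 : r < 1) (x : ℝ) :
    ENNReal.ofReal (√((1 - r) / n)) * ENNReal.ofReal (x * √(n / (1 - r)))
      = ENNReal.ofReal x := by
  have hn0 : (0 : ℝ) < n := by exact_mod_cast hn
  have hp : 0 < 1 - r := by linarith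
  rw [← ENNReal.ofReal_mul (Real.sqrt_nonneg _), mul_left_comm, ← Real.sqrt_mul (by positivity)]
  have : (1 - r) / n * (n / (1 - r)) = 1 := by field_simp
  rw [this, Real.sqrt_one, mul_one]

theorem le_liminf_normalized {r : ℝ} (hr : 0 ≤ r) (hr1 : r < 1) :
    ENNReal.ofReal (√((1 + r) / 2)) ≤ liminf (fun n : ℕ => ENNReal.ofReal (√((1 - r) / n)) *
      worstInterpConst hardyNorm dirichletNorm n r) atTop := by
  rw [← (ENNReal.tendsto_ofReal (tendsto_lower_factor r)).liminf_eq]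
  refine liminf_le_liminf ?_
  filter_upwards [eventually_ge_atTop 1] with n hn
  rw [← ofReal_sqrt_mul_ofReal hn hr1]
  gcongr
  exact le_worstInterpConst hn hr hr1

theorem limsup_normalized_le {r : ℝ} (hr : 0 ≤ r) (hr1 : r < 1) :
    limsup (fun n : ℕ => ENNReal.ofReal (√((1 - r) / n)) *
      worstInterpConst hardyNorm dirichletNorm n r) atTop ≤ ENNReal.ofReal (√(1 + r)) := by
  rw [← (ENNReal.tendsto_ofReal (tendsto_upper_factor r)).limsup_eq]
  refine limsup_le_limsup ?_
  filter_upwards [eventually_ge_atTop 1] with n hn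
  refine le_trans ?_ (ofReal_sqrt_mul_ofReal hn hr1 _).le
  gcongr
  exact worstInterpConst_le_ofReal hn hr hr1

end DirichletInterpolation

end

theorem theoremB :
    (∀ (n : ℕ) (r : ℝ), 1 ≤ n → 0 ≤ r → r < 1 →
      worstInterpConst hardyNorm dirichletNorm n r ≤
        ((bernsteinConst bergmanNorm hardyNorm n r) ^ 2 + 1) ^ (1 / 2 : ℝ)) ∧
    (∀ (n : ℕ) (z : ℂ), 1 ≤ n → ‖z‖ < 1 →
      ENNReal.ofReal (Real.sqrt (n / (1 - ‖z‖)) *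
          Real.sqrt (((1 + ‖z‖) ^ 2 - 2 / n - 2 * ‖z‖ / n) / (2 * (1 + ‖z‖)))) ≤
        interpConst hardyNorm dirichletNorm (Multiset.replicate n z)) ∧
    (∀ (n : ℕ) (r : ℝ), 1 ≤ n → 0 ≤ r → r < 1 →
      ENNReal.ofReal (Real.sqrt ((1 + r) / 2 * (1 - 1 / n)) * Real.sqrt (n / (1 - r))) ≤
          worstInterpConst hardyNorm dirichletNorm n r ∧
        worstInterpConst hardyNorm dirichletNorm n r ≤
          ENNReal.ofReal (Real.sqrt (1 + r + 1 / Real.sqrt n + (1 - r) / n) *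
            Real.sqrt (n / (1 - r)))) ∧
    (∃ c C : ℝ, 0 < c ∧ 0 < C ∧ ∀ (n : ℕ) (r : ℝ), 2 ≤ n → 0 ≤ r → r < 1 →
      ENNReal.ofReal (c * Real.sqrt (n / (1 - r))) ≤
          worstInterpConst hardyNorm dirichletNorm n r ∧
        worstInterpConst hardyNorm dirichletNorm n r ≤
          ENNReal.ofReal (C * Real.sqrt (n / (1 - r)))) ∧
    (∀ r : ℝ, 0 ≤ r → r < 1 →
      ENNReal.ofReal (Real.sqrt (((1 + r) / 2) / (1 - r))) ≤
          liminf (fun n : ℕ => worstInterpConst hardyNorm dirichletNorm n r /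
            ENNReal.ofReal (Real.sqrt n)) atTop ∧
        liminf (fun n : ℕ => worstInterpConst hardyNorm dirichletNorm n r /
            ENNReal.ofReal (Real.sqrt n)) atTop ≤
          limsup (fun n : ℕ => worstInterpConst hardyNorm dirichletNorm n r /
            ENNReal.ofReal (Real.sqrt n)) atTop ∧
        limsup (fun n : ℕ => worstInterpConst hardyNorm dirichletNorm n r /
            ENNReal.ofReal (Real.sqrt n)) atTop ≤
          ENNReal.ofReal (Real.sqrt ((1 + r) / (1 - r)))) ∧
    (ENNReal.ofReal (Real.sqrt 2 / 2) ≤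
        liminf (fun r : ℝ => liminf (fun n : ℕ => ENNReal.ofReal (Real.sqrt ((1 - r) / n)) *
          worstInterpConst hardyNorm dirichletNorm n r) atTop) (𝓝[<] (1 : ℝ)) ∧
      liminf (fun r : ℝ => liminf (fun n : ℕ => ENNReal.ofReal (Real.sqrt ((1 - r) / n)) *
          worstInterpConst hardyNorm dirichletNorm n r) atTop) (𝓝[<] (1 : ℝ)) ≤
        limsup (fun r : ℝ => limsup (fun n : ℕ => ENNReal.ofReal (Real.sqrt ((1 - r) / n)) *
          worstInterpConst hardyNorm dirichletNorm n r) atTop) (𝓝[<] (1 : ℝ)) ∧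
      limsup (fun r : ℝ => limsup (fun n : ℕ => ENNReal.ofReal (Real.sqrt ((1 - r) / n)) *
          worstInterpConst hardyNorm dirichletNorm n r) atTop) (𝓝[<] (1 : ℝ)) ≤
        ENNReal.ofReal (Real.sqrt 2)) := by
  refine ⟨fun n r _ hr hr1 => worstInterpConst_le hr hr1, ?_,
    fun n r hn hr hr1 => ⟨le_worstInterpConst hn hr hr1, worstInterpConst_le_ofReal hn hr hr1⟩,
    ⟨1 / 2, 2, by norm_num, by norm_num, ?_⟩,
    fun r hr hr1 => ⟨le_liminf_div_sqrt hr hr1, liminf_le_limsup, limsup_div_sqrt_le hr hr1⟩, ?_⟩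
  · intro n z hn hz
    refine le_trans (ENNReal.ofReal_le_ofReal ?_) (le_interpConst_replicate hn hz)
    have hn0 : (0 : ℝ) < n := by exact_mod_cast hn
    have hp : 0 < 1 - ‖z‖ := by linarith
    have hq : 0 < 1 + ‖z‖ := by positivity
    rw [← Real.sqrt_mul (by positivity)]
    refine Real.sqrt_le_sqrt ?_
    have e : n / (1 - ‖z‖) * (((1 + ‖z‖) ^ 2 - 2 / n - 2 * ‖z‖ / n) / (2 * (1 + ‖z‖)))
        = (n * (1 + ‖z‖) - 2) / (2 * (1 - ‖z‖)) := by
      field_simp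
      ring
    rw [e]
    gcongr
    linarith
  · intro n r hn hr hr1
    have hn2 : (2 : ℝ) ≤ n := by exact_mod_cast hn
    have hinv : 1 / (n : ℝ) ≤ 1 / 2 := one_div_le_one_div_of_le two_pos hn2
    constructor
    · refine le_trans ?_ (le_worstInterpConst (by omega) hr hr1)
      gcongr
      refine Real.le_sqrt_of_sq_le ?_
      nlinarith
    · refine (worstInterpConst_le_ofReal (by omega) hr hr1).trans ?_
      gcongr
      refine Real.sqrt_le_iff.mpr ⟨by norm_num, ?_⟩
      have h1 : 1 / √(n : ℝ) ≤ 1 := by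
        rw [div_le_one (Real.sqrt_pos.mpr (by linarith)), Real.one_le_sqrt]
        linarith
      have h2 : (1 - r) / n ≤ 1 := by
        rw [div_le_one (by linarith)]
        linarith
      linarith
  · have hev : ∀ᶠ r : ℝ in 𝓝[<] (1 : ℝ), 0 ≤ r ∧ r < 1 := by
      filter_upwards [Ioo_mem_nhdsLT (zero_lt_one (α := ℝ))] with r hr using ⟨hr.1.le, hr.2⟩
    refine ⟨le_liminf_of_le (by isBoundedDefault) ?_, ?_,
      limsup_le_of_le (by isBoundedDefault) ?_⟩
    · filter_upwards [hev] with r hr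
      refine le_trans (ENNReal.ofReal_le_ofReal ?_) (le_liminf_normalized hr.1 hr.2)
      refine Real.le_sqrt_of_sq_le ?_
      rw [div_pow, Real.sq_sqrt zero_le_two]
      linarith [hr.1]
    · exact (liminf_le_liminf (Eventually.of_forall fun r => liminf_le_limsup)).trans
        liminf_le_limsup
    · filter_upwards [hev] with r hr
      refine (limsup_normalized_le hr.1 hr.2).trans (ENNReal.ofReal_le_ofReal ?_)
      exact Real.sqrt_le_sqrt (by linarith [hr.2])
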